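/- **Setting.** Let $Y_1,Y_2,\ldots$ be independent random elements, not necessarily identically distributed, on one probability space, with values in possibly different measurable spaces. Let $\Theta\subseteq\mathbb R^p$ be open and convex (for instance $\Theta=\mathbb R^p$) and let $\theta_0\in\Theta$. For each $i$ let $g_i(y,\theta)$ be real valued, measurable in $y$ for each $\theta\in\Theta$ and convex in $\theta\in\Theta$ for each $y$. Let $\hat\theta_n$ be a random vector that, with probability tending to one, lies in $\Theta$ and minimises $\sum_{i\le n}g_i(Y_i,\theta)$ over $\theta\in\Theta$ (in particular, $\hat\theta_n$ may be such a minimiser always). Write $$g_i(y,\theta_0+t)-g_i(y,\theta_0)=D_i(y)^{\mathsf T}t+R_i(y,t),$$ where $D_i$ is measurable, $\mathrm E\,D_i(Y_i)=0$ and $D_i(Y_i)$ has a finite variance matrix $B_i$. For given $p\times p$ matrices $A_i$ write $$\mathrm E\,R_i(Y_i,t)=\tfrac12t^{\mathsf T}A_it+v_{i,0}(t),\qquad \mathrm{Var}\,R_i(Y_i,t)=v_i(t)\in[0,\infty],$$ with $v_i(t)=\infty$ when $R_i(Y_i,t)$ is not square integrable, and let $J_n=\sum_{i\le n}A_i$ and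 $K_n=\sum_{i\le n}B_i$. For positive definite $M$, $M^{1/2}$ is the symmetric positive definite root and $M^{-1/2}$ its inverse. An array of random vectors $X_{n,i}$, $i\le n$, satisfies the Lindeberg conditions if $\sum_{i\le n}\mathrm E\,(s^{\mathsf T}X_{n,i})^2\,I\{|s^{\mathsf T}X_{n,i}|\ge\delta\}\to0$ for each $s\in\mathbb R^p$ and each $\delta>0$. **(a)** Assume that $\sum_{i\le n}v_{i,0}(s/\sqrt n)\to0$ and $\sum_{i\le n}v_i(s/\sqrt n)\to0$ for each $s\in\mathbb R^p$, and that $J_n/n\to J$ and $K_n/n\to K$, where $J$ is symmetric and positive definite. Then $$\sqrt n(\hat\theta_n-\theta_0)=-J^{-1}n^{-1/2}\sum_{i\le n}D_i(Y_i)+o_p(1).$$ If in addition the array $n^{-1/2}D_i(Y_i)$ satisfies the Lindeberg conditions, then $\sqrt n(\hat\theta_n-\theta_0)\to_d N_p(0,J^{-1}KJ^{-1})$. **(b)** Assume that $J_n$ and $K_n$ are symmetric and positive definite for all large $n$, that for each $s\in\mathbb R^p$ the point $\theta_0+J_n^{-1/2}s$ lies in $\Theta$ for all large $n$ (which is automatic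 when $\Theta=\mathbb R^p$), that $\sum_{i\le n}v_{i,0}(J_n^{-1/2}s)\to0$ and $\sum_{i\le n}v_i(J_n^{-1/2}s)\to0$ for each $s\in\mathbb R^p$, and that $J_n^{-1}K_n$ is bounded. Then $$J_n^{1/2}(\hat\theta_n-\theta_0)=-J_n^{-1/2}K_n^{1/2}U_n+o_p(1),\qquad U_n=K_n^{-1/2}\sum_{i\le n}D_i(Y_i).$$ If in addition the array $K_n^{-1/2}D_i(Y_i)$ satisfies the Lindeberg conditions, then $U_n\to_dN_p(0,I_p)$; and if moreover $J_n^{-1/2}K_nJ_n^{-1/2}\to J^{-1/2}KJ^{-1/2}$ for some $p\times p$ matrices $J$ and $K$ with $J$ symmetric and positive definite, then $J_n^{1/2}(\hat\theta_n-\theta_0)\to_dN_p(0,J^{-1/2}KJ^{-1/2})$. -/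

import Mathlib

open MeasureTheory ProbabilityTheory Filter Topology Matrix
open scoped ENNReal MatrixOrder

namespace ConvexMin

noncomputable section

/-- `ℝ^p` with its Euclidean norm and inner product. -/
abbrev E (p : ℕ) : Type := EuclideanSpace ℝ (Fin p)

/-- The action `x ↦ M x` of a matrix on `ℝ^p`. -/
def act {p : ℕ} (M : Matrix (Fin p) (Fin p) ℝ) (x : E p) : E p :=
  Matrix.toEuclideanCLM (𝕜 := ℝ) M x

/-- The symmetric root `M^{1/2}` of a positive semidefinite matrix. -/
def rt {p : ℕ} (M : Matrix (Fin p) (Fin p) ℝ) : Matrix (Fin p) (Fin p) ℝ := CFC.sqrt M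

/-- `M^{-1/2}`, for a positive definite matrix `M`. -/
def invRt {p : ℕ} (M : Matrix (Fin p) (Fin p) ℝ) : Matrix (Fin p) (Fin p) ℝ := (rt M)⁻¹

/-- The remainder `R_i(y,t)`, defined through
`g_i(y, θ₀ + t) - g_i(y, θ₀) = D_i(y)' t + R_i(y,t)`. -/
def rem {p : ℕ} {𝓨 : ℕ → Type*} (g : ∀ i, 𝓨 i → E p → ℝ) (θ₀ : E p) (D : ∀ i, 𝓨 i → E p)
    (i : ℕ) (y : 𝓨 i) (t : E p) : ℝ :=
  g i y (θ₀ + t) - g i y θ₀ - inner ℝ (D i y) t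

/-- `v_{i,0}(t)`, defined through `E R_i(Y_i,t) = ½ t' A_i t + v_{i,0}(t)`. -/
def meanErr {Ω : Type*} [MeasurableSpace Ω] (μ : Measure Ω) {p : ℕ} {𝓨 : ℕ → Type*}
    (Y : ∀ i, Ω → 𝓨 i) (g : ∀ i, 𝓨 i → E p → ℝ) (θ₀ : E p) (D : ∀ i, 𝓨 i → E p)
    (A : ℕ → Matrix (Fin p) (Fin p) ℝ) (i : ℕ) (t : E p) : ℝ :=
  (∫ ω, rem g θ₀ D i (Y i ω) t ∂μ) - (1 / 2) * inner ℝ t (act (A i) t)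

/-- `v_i(t) = Var R_i(Y_i,t)`, as an extended real: it is `∞` when `R_i(Y_i,t)` is not
square integrable, so that a finite value carries the existence of the first two moments. -/
def remVar {Ω : Type*} [MeasurableSpace Ω] (μ : Measure Ω) {p : ℕ} {𝓨 : ℕ → Type*}
    (Y : ∀ i, Ω → 𝓨 i) (g : ∀ i, 𝓨 i → E p → ℝ) (θ₀ : E p) (D : ∀ i, 𝓨 i → E p)
    (i : ℕ) (t : E p) : ℝ≥0∞ :=
  evariance (fun ω => rem g θ₀ D i (Y i ω) t) μ

/-- The variance matrix of a random vector. -/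
def varMatrix {Ω : Type*} [MeasurableSpace Ω] (μ : Measure Ω) {p : ℕ} (X : Ω → E p) :
    Matrix (Fin p) (Fin p) ℝ :=
  Matrix.of fun a b => covariance (fun ω => X ω a) (fun ω => X ω b) μ

/-- `J_n`, the sum of the first `n` of the matrices `A_i`. -/
def Jsum {p : ℕ} (A : ℕ → Matrix (Fin p) (Fin p) ℝ) (n : ℕ) : Matrix (Fin p) (Fin p) ℝ :=
  ∑ i ∈ Finset.range n, A i

/-- `K_n`, the sum of the variance matrices of the first `n` of the vectors `D_i(Y_i)`. -/
def Ksum {Ω : Type*} [MeasurableSpace Ω] (μ : Measure Ω) {p : ℕ} {𝓨 : ℕ → Type*}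
    (Y : ∀ i, Ω → 𝓨 i) (D : ∀ i, 𝓨 i → E p) (n : ℕ) : Matrix (Fin p) (Fin p) ℝ :=
  ∑ i ∈ Finset.range n, varMatrix μ (fun ω => D i (Y i ω))

/-- The sum of the first `n` of the vectors `D_i(Y_i)`. -/
def Dsum {Ω : Type*} {p : ℕ} {𝓨 : ℕ → Type*}
    (Y : ∀ i, Ω → 𝓨 i) (D : ∀ i, 𝓨 i → E p) (n : ℕ) (ω : Ω) : E p :=
  ∑ i ∈ Finset.range n, D i (Y i ω)

/-- `U_n`, the sum of the first `n` of the `D_i(Y_i)` multiplied by `K_n^{-1/2}`. -/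
def Ustd {Ω : Type*} [MeasurableSpace Ω] (μ : Measure Ω) {p : ℕ} {𝓨 : ℕ → Type*}
    (Y : ∀ i, Ω → 𝓨 i) (D : ∀ i, 𝓨 i → E p) (n : ℕ) (ω : Ω) : E p :=
  act (invRt (Ksum μ Y D n)) (Dsum Y D n ω)

/-- The Lindeberg conditions for a triangular array of centred square integrable random vectors
`X n i`, `i < n`: for each `s` and each `δ > 0`,
`∑_{i<n} E (s' X_{n,i})² I{|s' X_{n,i}| ≥ δ} → 0`. -/
def Lindeberg {Ω : Type*} [MeasurableSpace Ω] (μ : Measure Ω) {p : ℕ}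
    (X : ℕ → ℕ → Ω → E p) : Prop :=
  ∀ (s : E p) (δ : ℝ), 0 < δ →
    Tendsto (fun n : ℕ => ∑ i ∈ Finset.range n,
      ∫ ω in {ω | δ ≤ |inner ℝ s (X n i ω)|}, (inner ℝ s (X n i ω)) ^ 2 ∂μ) atTop (𝓝 0)

end

end ConvexMin

/-! The criterion is localised: with a normalising matrix `L n`, the random function `s ↦ ∑
(g_i(Y_i, θ₀ + L_n s) - g_i(Y_i, θ₀))` is convex and is minimised at the normalised estimator. Its
linear part has the random slope `L_n ∑ D_i(Y_i)`. The remainders sum, for each fixed `s`, to `½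
sᵀJs + o_p(1)`: the means supply the quadratic and Chebyshev's inequality disposes of the rest. So
the function is pointwise close to a quadratic whose minimiser is `u_n = -J⁻¹ L_n ∑ D_i(Y_i)`.

Convexity replaces every smoothness or uniformity assumption. Convex functions close to a fixed
convex function at a suitable finite set of points are close to it uniformly on a ball
(`exists_finset_forall_convexOn_abs_sub_le`), and then the minimisers must be close too
(`exists_finset_norm_argmin_sub_le`). As the finite set serves all bounded `u`, and `u_n` is bounded
in probability by its second moment, the argument passes to random functions
(`tendstoInMeasure_argmin_sub`, `tendstoInMeasure_act_argmin_sub`).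

The two normalisations are `L_n = n^{-1/2} I` with limit `J`, and `L_n = J_n^{-1/2}` with limit `I`.
The normal limits follow from Lindeberg's theorem for characteristic functions, with arguments
allowed to vary with `n` within a bounded set, and from Slutsky's lemma. -/

namespace ConvexMin

noncomputable section

/-! ### Uniform closeness of convex functions from closeness at finitely many points. -/

section FiniteApproximation

open scoped Pointwise

variable {V : Type*} [NormedAddCommGroup V] [NormedSpace ℝ V]

/-- A simplex with the origin in its interior contains a ball of some radius `r`; dilation by `R /
r` enlarges that ball to radius `R`. -/
lemma exists_finset_ball_subset_convexHull [FiniteDimensional ℝ V] {R : ℝ} (hR : 0 < R) :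
    ∃ F : Finset V, Metric.ball (0 : V) R ⊆ convexHull ℝ (F : Set V) := by
  classical
  obtain ⟨b, hb, -⟩ := exists_mem_interior_convexHull_affineBasis (x := (0 : V)) univ_mem
  obtain ⟨r, hr, hbr⟩ := Metric.mem_nhds_iff.1 (mem_interior_iff_mem_nhds.1 hb)
  have hc : 0 < R / r := by positivity
  refine ⟨Finset.univ.image fun i => (R / r) • b i, fun x hx => ?_⟩
  have h1 : ((Finset.univ.image fun i => (R / r) • b i : Finset V) : Set V)
      = (R / r) • Set.range b := by
    ext y; simp [Set.mem_smul_set]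
  rw [h1, convexHull_smul, Set.mem_smul_set_iff_inv_smul_mem₀ hc.ne']
  apply hbr
  rw [mem_ball_zero_iff] at hx ⊢
  rw [norm_smul, Real.norm_of_nonneg (by positivity), inv_div]
  calc r / R * ‖x‖ < r / R * R := by gcongr
    _ = r := by field_simp

/-- A convex function that is bounded at the origin and at the points of a set is bounded on each
centred ball in the convex hull of that set. -/
lemma abs_le_of_convexOn_of_ball_subset_convexHull {S : Set V} {h : V → ℝ} {F : Finset V}
    {r M : ℝ} (hh : ConvexOn ℝ S h) (hF : Metric.ball (0 : V) r ⊆ convexHull ℝ (F : Set V))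
    (hFS : (F : Set V) ⊆ S) (hM : ∀ s ∈ F, |h s| ≤ M) (h0 : |h 0| ≤ M)
    {x : V} (hx : x ∈ Metric.ball (0 : V) r) : |h x| ≤ 3 * M := by
  have hup : ∀ y ∈ Metric.ball (0 : V) r, h y ≤ M := fun y hy => by
    obtain ⟨z, hz, hyz⟩ := hh.exists_ge_of_mem_convexHull hFS (hF hy)
    exact hyz.trans ((le_abs_self _).trans (hM z hz))
  have hsub : Metric.ball (0 : V) r ⊆ S := hF.trans (convexHull_min hFS hh.1)
  -- The lower bound comes from the midpoint `0` of `x` and `-x`: `h x ≥ 2 h 0 - h (-x) ≥ -3M`.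
  have hnx : -x ∈ Metric.ball (0 : V) r := by simpa using hx
  have hmid := hh.2 (hsub hx) (hsub hnx) (by norm_num : (0 : ℝ) ≤ 1 / 2)
    (by norm_num : (0 : ℝ) ≤ 1 / 2) (by norm_num)
  have hz : (1 / 2 : ℝ) • x + (1 / 2 : ℝ) • -x = 0 := by simp
  rw [hz, smul_eq_mul, smul_eq_mul] at hmid
  have h1 := hup x hx
  have h2 := hup (-x) hnx
  have h3 := abs_le.1 h0
  rw [abs_le]
  constructor <;> linarith [h3.1, h3.2]

/-- On a given ball, a convex function is uniformly close to a given convex function as soon as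
the two are close at finitely many points, which do not depend on the function. -/
lemma exists_finset_forall_convexOn_abs_sub_le [FiniteDimensional ℝ V] {q : V → ℝ}
    (hq : ConvexOn ℝ Set.univ q) {R δ : ℝ} (hR : 0 < R) (hδ : 0 < δ) :
    ∃ F : Finset V, ∃ η > 0, ∀ (S : Set V) (h : V → ℝ), ConvexOn ℝ S h → (F : Set V) ⊆ S →
      (∀ s ∈ F, |h s - q s| ≤ η) →
      Metric.ball (0 : V) R ⊆ S ∧ ∀ s ∈ Metric.ball (0 : V) R, |h s - q s| ≤ δ := by
  classical
  -- The extra radius `1` is the margin in which boundedness yields a Lipschitz bound on the ball of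
  -- radius `R`. The `+ 1` in `M` makes it bound `h` as well as `q`, since `h` is within `1` of `q`
  -- at these points.
  obtain ⟨F₀, hF₀⟩ := exists_finset_ball_subset_convexHull (V := V) (R := R + 1) (by linarith)
  set M : ℝ := (∑ s ∈ insert 0 F₀, |q s|) + 1 with hMdef
  have hqM : ∀ s ∈ insert 0 F₀, |q s| ≤ M - 1 := fun s hs => by
    have := Finset.single_le_sum (f := fun s => |q s|) (fun _ _ => abs_nonneg _) hs
    simpa [hMdef] using this
  have hM1 : 1 ≤ M := by
    have : 0 ≤ ∑ s ∈ insert 0 F₀, |q s| := Finset.sum_nonneg fun _ _ => abs_nonneg _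
    linarith
  set L : ℝ := 2 * (3 * M) / 1 with hL
  have hLpos : 0 < L := by rw [hL]; positivity
  have hlip : ∀ (S : Set V) (h : V → ℝ), ConvexOn ℝ S h → ((insert 0 F₀ : Finset V) : Set V) ⊆ S →
      (∀ s ∈ insert 0 F₀, |h s| ≤ M) → Metric.ball (0 : V) (R + 1) ⊆ S ∧
        ∀ x ∈ Metric.ball (0 : V) R, ∀ y ∈ Metric.ball (0 : V) R, |h x - h y| ≤ L * dist x y := by
    intro S h hh hFS hhM
    have hsub : Metric.ball (0 : V) (R + 1) ⊆ S :=
      hF₀.trans (convexHull_min (fun x hx => hFS (by simp_all)) hh.1)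
    refine ⟨hsub, fun x hx y hy => ?_⟩
    have hl := (hh.subset hsub (convex_ball _ _)).lipschitzOnWith_of_abs_le (ε := 1)
      (M := 3 * M) one_pos (fun a ha =>
        abs_le_of_convexOn_of_ball_subset_convexHull hh hF₀ (fun x hx => hFS (by simp_all))
          (fun s hs => hhM s (by simp [hs])) (hhM 0 (by simp)) ha)
    rw [add_sub_cancel_right] at hl
    have := hl.dist_le_mul x hx y hy
    rwa [Real.dist_eq, Real.coe_toNNReal _ hLpos.le] at this
  have : ProperSpace V := FiniteDimensional.proper_real V
  have htb : TotallyBounded (Metric.ball (0 : V) R) :=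
    (isCompact_closedBall (0 : V) R).totallyBounded.subset Metric.ball_subset_closedBall
  -- On a net of mesh `δ / (3L)` the oscillations of `h` and of `q` cost `δ / 3` each, and closeness
  -- at the net point costs the last third.
  obtain ⟨t, htsub, htfin, htcov⟩ :=
    Metric.finite_approx_of_totallyBounded htb (δ / (3 * L)) (by positivity)
  refine ⟨insert 0 F₀ ∪ htfin.toFinset, min 1 (δ / 3), by positivity, ?_⟩
  intro S h hh hFS hclose
  obtain ⟨hsub, hhlip⟩ := hlip S h hh (fun x hx => hFS (by
      simp only [Finset.coe_union]; exact Or.inl hx)) (fun s hs => by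
    have h1 := hclose s (by simp only [Finset.mem_union]; exact Or.inl hs)
    have h2 := hqM s hs
    have h3 := h1.trans (min_le_left _ _)
    have h4 := abs_sub_abs_le_abs_sub (h s) (q s)
    linarith)
  obtain ⟨-, hqlip⟩ := hlip Set.univ q hq (Set.subset_univ _) (fun s hs => by linarith [hqM s hs])
  refine ⟨(Metric.ball_subset_ball (by linarith)).trans hsub, fun s hs => ?_⟩
  obtain ⟨y, hy, hsy⟩ := Set.mem_iUnion₂.1 (htcov hs)
  have hyb := htsub hy
  have h1 := hhlip s hs y hyb
  have h2 := hqlip s hs y hyb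
  have h3 := (hclose y (by simp [hy])).trans (min_le_right _ _)
  have h4 : L * dist s y ≤ δ / 3 := by
    have : dist s y ≤ δ / (3 * L) := (Metric.mem_ball.1 hsy).le
    calc L * dist s y ≤ L * (δ / (3 * L)) := by gcongr
      _ = δ / 3 := by field_simp
  have h5 : h s - q s = (h s - h y) + (h y - q y) - (q s - q y) := by ring
  rw [h5, abs_le]
  rw [abs_le] at h1 h2 h3
  constructor <;> linarith [h1.1, h1.2, h2.1, h2.2, h3.1, h3.2]

end FiniteApproximation

/-! ### Minimisers of convex functions close to a quadratic. -/

section Argmin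

variable {V : Type*} [NormedAddCommGroup V] [InnerProductSpace ℝ V]

/-- Completing the square at `u`, by the symmetry of `T`. -/
lemma quadratic_eq_shifted {T : V →L[ℝ] V} (hT : ∀ x y, inner ℝ (T x) y = inner ℝ x (T y))
    (u s : V) : 1 / 2 * inner ℝ s (T s) - inner ℝ (T u) s
      = 1 / 2 * inner ℝ (s - u) (T (s - u)) - 1 / 2 * inner ℝ u (T u) := by
  have h1 : inner ℝ s (T u) = inner ℝ (T u) s := real_inner_comm _ _
  have h2 : inner ℝ u (T s) = inner ℝ (T u) s := (hT u s).symm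
  simp only [map_sub, inner_sub_left, inner_sub_right]
  rw [h1, h2]
  ring

/-- The convexity gap at weights `a`, `b` is `½ ab ⟨x - y, T(x - y)⟩`. -/
lemma convexOn_quadratic {T : V →L[ℝ] V} (hT : ∀ x y, inner ℝ (T x) y = inner ℝ x (T y))
    (hpos : ∀ x, 0 ≤ inner ℝ x (T x)) :
    ConvexOn ℝ Set.univ fun s => 1 / 2 * inner ℝ s (T s) := by
  refine ⟨convex_univ, fun x _ y _ a b ha hb hab => ?_⟩
  have h := hpos (x - y)
  have h2 : inner ℝ x (T y) = inner ℝ y (T x) := by rw [← hT, real_inner_comm]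
  simp only [map_add, map_sub, map_smul, inner_add_left, inner_add_right, inner_sub_left,
    inner_sub_right, real_inner_smul_left, real_inner_smul_right, smul_eq_mul, h2] at h ⊢
  obtain rfl : b = 1 - a := by linarith
  nlinarith [mul_nonneg (mul_nonneg ha hb) h]

/-- A convex function that is close, at finitely many points, to a nondegenerate quadratic
function with minimiser `u` has its minimisers near `u`, uniformly for bounded `u`. -/
lemma exists_finset_norm_argmin_sub_le [FiniteDimensional ℝ V] {T : V →L[ℝ] V}
    (hT : ∀ x y, inner ℝ (T x) y = inner ℝ x (T y)) {c : ℝ} (hc : 0 < c)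
    (hcoer : ∀ x, c * ‖x‖ ^ 2 ≤ inner ℝ x (T x)) {R ε : ℝ} (hR : 0 < R) (hε : 0 < ε) :
    ∃ F : Finset V, ∃ η > 0, ∀ (S : Set V) (f : V → ℝ) (u m : V), ConvexOn ℝ S f →
      (F : Set V) ⊆ S → ‖u‖ ≤ R →
      (∀ s ∈ F, |f s - (1 / 2 * inner ℝ s (T s) - inner ℝ (T u) s)| ≤ η) →
      m ∈ S → IsMinOn f S m → ‖m - u‖ ≤ ε := by
  have hpos : ∀ x, 0 ≤ inner ℝ x (T x) := fun x => le_trans (by positivity) (hcoer x)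
  -- At distance `ε` from `u` the quadratic exceeds its minimum by at least `cε²/2`, while two
  -- approximation errors amount to `2δ = cε²/4` only.
  set δ : ℝ := c * ε ^ 2 / 8 with hδ
  have hδpos : 0 < δ := by positivity
  obtain ⟨F, η, hη, H⟩ := exists_finset_forall_convexOn_abs_sub_le (convexOn_quadratic hT hpos)
    (R := R + ε + 1) (by positivity) hδpos
  refine ⟨F, η, hη, fun S f u m hf hFS hu hclose hmS hmin => ?_⟩
  -- Adding the linear term to `f` leaves a target quadratic free of `u`, so `F` and `η` can be
  -- chosen before `u`.
  obtain ⟨hsub, hunif⟩ := H S (fun s => f s + inner ℝ (T u) s)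
    (hf.add ((innerSL ℝ (T u)).toLinearMap.convexOn hf.1)) hFS (fun s hs => by
      have := hclose s hs
      convert this using 2
      ring)
  by_contra! hlt
  have hd : 0 < ‖m - u‖ := hε.trans hlt
  -- A minimiser farther than `ε` from `u` is pulled back along the segment to the sphere of radius
  -- `ε`, where convexity still gives `f s ≤ f u`.
  set a : ℝ := ε / ‖m - u‖ with ha
  have ha0 : 0 < a := by positivity
  have ha1 : a < 1 := (div_lt_one hd).2 hlt
  set s : V := (1 - a) • u + a • m with hs
  have hsu : s - u = a • (m - u) := by rw [hs]; module
  have hnorm : ‖s - u‖ = ε := by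
    rw [hsu, norm_smul, Real.norm_of_nonneg ha0.le, ha, div_mul_cancel₀ _ hd.ne']
  have huB : u ∈ Metric.ball (0 : V) (R + ε + 1) := by
    rw [mem_ball_zero_iff]; linarith
  have hsB : s ∈ Metric.ball (0 : V) (R + ε + 1) := by
    rw [mem_ball_zero_iff]
    have : ‖s‖ ≤ ‖s - u‖ + ‖u‖ := by simpa using norm_add_le (s - u) u
    linarith
  have hcv := hf.2 (hsub huB) hmS (sub_nonneg.2 ha1.le) ha0.le (by ring)
  have hfm : f m ≤ f u := hmin (hsub huB)
  rw [← hs, smul_eq_mul, smul_eq_mul] at hcv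
  have hfs : f s ≤ f u := by nlinarith
  have h1 := (abs_le.1 (hunif s hsB)).1
  have h2 := (abs_le.1 (hunif u huB)).2
  have h3 := quadratic_eq_shifted hT u s
  have h4 := quadratic_eq_shifted hT u u
  have h5 := hcoer (s - u)
  rw [hnorm] at h5
  simp only [sub_self, map_zero, inner_zero_left] at h4
  nlinarith

end Argmin

/-! ### Transfer to random convex functions. -/

section StochasticArgmin

variable {V : Type*} [NormedAddCommGroup V] [InnerProductSpace ℝ V] [FiniteDimensional ℝ V]
  {Ω : Type*} [MeasurableSpace Ω] {μ : Measure Ω}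

/-- Minimisers of random convex functions that are pointwise close in probability to a quadratic
function with minimiser `u n` are close to `u n` in probability. -/
lemma tendstoInMeasure_argmin_sub {T : V →L[ℝ] V}
    (hT : ∀ x y, inner ℝ (T x) y = inner ℝ x (T y)) {c : ℝ} (hc : 0 < c)
    (hcoer : ∀ x, c * ‖x‖ ^ 2 ≤ inner ℝ x (T x))
    {S : ℕ → Set V} {f : ℕ → Ω → V → ℝ} {u m : ℕ → Ω → V}
    (hf : ∀ᶠ n in atTop, ∀ ω, ConvexOn ℝ (S n) (f n ω)) (hS : ∀ s, ∀ᶠ n in atTop, s ∈ S n)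
    (hu : ∀ ε : ℝ≥0∞, 0 < ε → ∃ R : ℝ, 0 < R ∧ ∀ᶠ n in atTop, μ {ω | R < ‖u n ω‖} ≤ ε)
    (hclose : ∀ s, TendstoInMeasure μ
      (fun n ω => f n ω s - (1 / 2 * inner ℝ s (T s) - inner ℝ (T (u n ω)) s)) atTop fun _ => 0)
    (hm : Tendsto (fun n => μ {ω | ¬ (m n ω ∈ S n ∧ IsMinOn (f n ω) (S n) (m n ω))})
      atTop (𝓝 0)) :
    TendstoInMeasure μ (fun n ω => m n ω - u n ω) atTop fun _ => 0 := by
  classical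
  rw [tendstoInMeasure_iff_norm]
  intro ε hε
  rw [ENNReal.tendsto_nhds_zero]
  intro κ hκ
  obtain ⟨R, hR, huR⟩ := hu (κ / 2) (ENNReal.half_pos hκ.ne')
  obtain ⟨F, η, hη, H⟩ := exists_finset_norm_argmin_sub_le hT hc hcoer hR (half_pos hε)
  have hFS : ∀ᶠ n in atTop, (F : Set V) ⊆ S n := by
    have : ∀ᶠ n in atTop, ∀ s ∈ F, s ∈ S n := (eventually_all_finset F).2 fun s _ => hS s
    exact this
  have hsum : Tendsto (fun n => (∑ s ∈ F, μ {ω | η ≤ ‖f n ω s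
      - (1 / 2 * inner ℝ s (T s) - inner ℝ (T (u n ω)) s) - 0‖})
      + μ {ω | ¬ (m n ω ∈ S n ∧ IsMinOn (f n ω) (S n) (m n ω))}) atTop (𝓝 0) := by
    have h1 : Tendsto (fun n => ∑ s ∈ F, μ {ω | η ≤ ‖f n ω s
        - (1 / 2 * inner ℝ s (T s) - inner ℝ (T (u n ω)) s) - 0‖}) atTop
        (𝓝 (∑ _s ∈ F, 0)) :=
      tendsto_finsetSum _ fun s _ => tendstoInMeasure_iff_norm.1 (hclose s) η hη
    simpa using h1.add hm
  rw [ENNReal.tendsto_nhds_zero] at hsum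
  filter_upwards [hf, huR, hFS, hsum (κ / 2) (ENNReal.half_pos hκ.ne')] with n hfn hun hFn hsn
  -- Outside three bad events (large `u n`, a poor fit at some point of `F`, no minimisation) the
  -- deterministic lemma gives distance at most `ε / 2`. Monotonicity and subadditivity require no
  -- measurability of these events.
  calc μ {ω | ε ≤ ‖m n ω - u n ω - 0‖}
      ≤ μ ({ω | R < ‖u n ω‖} ∪ ((⋃ s ∈ F, {ω | η ≤ ‖f n ω s
        - (1 / 2 * inner ℝ s (T s) - inner ℝ (T (u n ω)) s) - 0‖})
        ∪ {ω | ¬ (m n ω ∈ S n ∧ IsMinOn (f n ω) (S n) (m n ω))})) := by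
        refine measure_mono fun ω hω => ?_
        by_contra hcon
        simp only [Set.mem_union, Set.mem_iUnion, Set.mem_ofPred_eq, not_or, not_lt, not_exists,
          not_le, exists_prop, not_and, sub_zero] at hcon hω
        obtain ⟨h1, h2, h3⟩ := hcon
        obtain ⟨h3, h4⟩ := not_not.1 (fun h => h3 (not_and.1 h))
        have := H (S n) (f n ω) (u n ω) (m n ω) (hfn ω) hFn h1 (fun s hs => (h2 s hs).le) h3 h4
        linarith
    _ ≤ κ / 2 + κ / 2 := by
        refine (measure_union_le _ _).trans (add_le_add hun ?_)
        refine (measure_union_le _ _).trans (le_trans ?_ hsn)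
        gcongr
        exact measure_biUnion_finset_le _ _
    _ = κ := ENNReal.add_halves κ

end StochasticArgmin

/-! ### Lindeberg's theorem for real triangular arrays. -/

section LindebergScalar

/-- For `|X| < δ` the cube gains a factor `δ` over the variance. The quadratic bound of the next
lemma serves for `|X| ≥ δ`, where only second moments are available. -/
lemma norm_cexp_mul_I_sub_taylor_le_cube {x : ℝ} (hx : |x| ≤ 1) :
    ‖Complex.exp (x * Complex.I) - (1 + x * Complex.I - x ^ 2 / 2)‖ ≤ |x| ^ 3 := by
  have hn : ‖(x * Complex.I : ℂ)‖ = |x| := by simp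
  have h := Complex.exp_bound (x := x * Complex.I) (by rwa [hn]) (n := 3) (by norm_num)
  rw [hn] at h
  have hs : ∑ m ∈ Finset.range 3, (x * Complex.I : ℂ) ^ m / m.factorial
      = 1 + x * Complex.I - x ^ 2 / 2 := by
    simp [Finset.sum_range_succ, mul_pow]
    ring
  rw [hs] at h
  refine h.trans ?_
  have : (0 : ℝ) ≤ |x| ^ 3 := by positivity
  norm_num [Nat.factorial]
  linarith

lemma norm_cexp_mul_I_sub_taylor_le_sq (x : ℝ) :
    ‖Complex.exp (x * Complex.I) - (1 + x * Complex.I - x ^ 2 / 2)‖ ≤ 3 * x ^ 2 := by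
  rcases le_total |x| 1 with hx | hx
  · refine (norm_cexp_mul_I_sub_taylor_le_cube hx).trans ?_
    rw [← sq_abs x]
    nlinarith [sq_nonneg |x|, abs_nonneg x]
  · have h1 : ‖Complex.exp (x * Complex.I) - 1‖ ≤ |x| := by
      have := Real.norm_exp_I_mul_ofReal_sub_one_le (x := x)
      rwa [mul_comm, Real.norm_eq_abs] at this
    have h2 : ‖(x * Complex.I : ℂ)‖ = |x| := by simp
    have h3 : ‖((x : ℂ) ^ 2 / 2)‖ = |x| ^ 2 / 2 := by simp
    calc ‖Complex.exp (x * Complex.I) - (1 + x * Complex.I - x ^ 2 / 2)‖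
        = ‖(Complex.exp (x * Complex.I) - 1) - x * Complex.I + x ^ 2 / 2‖ := by congr 1; ring
      _ ≤ |x| + |x| + |x| ^ 2 / 2 := by
          refine (norm_add_le _ _).trans (add_le_add ((norm_sub_le _ _).trans ?_) h3.le)
          exact add_le_add h1 h2.le
      _ ≤ 3 * x ^ 2 := by rw [← sq_abs x]; nlinarith

/-- Factors are exchanged one at a time; the remaining ones lie in the unit disc and do not enlarge
the error. -/
lemma norm_prod_sub_prod_le_sum {ι : Type*} (s : Finset ι) (a b : ι → ℂ)
    (ha : ∀ i ∈ s, ‖a i‖ ≤ 1) (hb : ∀ i ∈ s, ‖b i‖ ≤ 1) :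
    ‖∏ i ∈ s, a i - ∏ i ∈ s, b i‖ ≤ ∑ i ∈ s, ‖a i - b i‖ := by
  classical
  induction s using Finset.induction_on with
  | empty => simp
  | insert i s hi ih =>
    rw [Finset.prod_insert hi, Finset.prod_insert hi, Finset.sum_insert hi]
    have ih' := ih (fun j hj => ha j (by simp [hj])) (fun j hj => hb j (by simp [hj]))
    have hp : ‖∏ j ∈ s, a j‖ ≤ 1 := by
      rw [norm_prod]
      exact Finset.prod_le_one (fun _ _ => norm_nonneg _) fun j hj => ha j (by simp [hj])
    calc ‖a i * ∏ j ∈ s, a j - b i * ∏ j ∈ s, b j‖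
        = ‖(a i - b i) * ∏ j ∈ s, a j + b i * (∏ j ∈ s, a j - ∏ j ∈ s, b j)‖ := by
          congr 1; ring
      _ ≤ ‖a i - b i‖ * ‖∏ j ∈ s, a j‖ + ‖b i‖ * ‖∏ j ∈ s, a j - ∏ j ∈ s, b j‖ := by
          refine (norm_add_le _ _).trans ?_
          rw [norm_mul, norm_mul]
      _ ≤ ‖a i - b i‖ * 1 + 1 * ∑ j ∈ s, ‖a j - b j‖ := by
          gcongr
          exact hb i (by simp)
      _ = _ := by ring

/-- Follows from `1 - y ≤ e^{-y} ≤ 1 / (1 + y)`. -/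
lemma norm_cexp_neg_sub_one_sub_le {y : ℝ} (hy : 0 ≤ y) :
    ‖Complex.exp (-y : ℂ) - (1 - y)‖ ≤ y ^ 2 := by
  have h : Complex.exp (-y : ℂ) - (1 - y) = ((Real.exp (-y) - (1 - y) : ℝ) : ℂ) := by
    push_cast; rfl
  rw [h, Complex.norm_real, Real.norm_eq_abs]
  have h1 : 1 - y ≤ Real.exp (-y) := by linarith [Real.add_one_le_exp (-y)]
  rw [abs_of_nonneg (by linarith)]
  have h2 : (1 + y) * Real.exp (-y) ≤ 1 := by
    have := Real.add_one_le_exp y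
    calc (1 + y) * Real.exp (-y) ≤ Real.exp y * Real.exp (-y) := by
          gcongr; linarith
      _ = 1 := by rw [← Real.exp_add]; simp
  nlinarith [Real.exp_pos (-y)]

variable {Ω : Type*} [MeasurableSpace Ω] {μ : Measure Ω} [IsProbabilityMeasure μ]

/-- Under the Lindeberg conditions this makes the individual variances uniformly small, so that
their squares are negligible in the sum. -/
lemma integral_sq_le_sq_add_setIntegral {X : Ω → ℝ} (hX : Measurable X) (h2 : MemLp X 2 μ)
    {δ : ℝ} (hδ : 0 < δ) :
    ∫ ω, X ω ^ 2 ∂μ ≤ δ ^ 2 + ∫ ω in {ω | δ ≤ |X ω|}, X ω ^ 2 ∂μ := by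
  have hms : MeasurableSet {ω | δ ≤ |X ω|} := measurableSet_le measurable_const hX.abs
  rw [← integral_indicator hms]
  have hint : Integrable (fun ω => X ω ^ 2) μ := h2.integrable_sq
  calc ∫ ω, X ω ^ 2 ∂μ
      ≤ ∫ ω, (δ ^ 2 + Set.indicator {ω | δ ≤ |X ω|} (fun ω => X ω ^ 2) ω) ∂μ := by
        refine integral_mono hint ((integrable_const _).add (hint.indicator hms)) fun ω => ?_
        by_cases hω : ω ∈ {ω | δ ≤ |X ω|}
        · simp only [Set.indicator_of_mem hω]
          nlinarith
        · simp only [Set.indicator_of_notMem hω]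
          have : |X ω| < δ := not_le.1 hω
          rw [← sq_abs]
          nlinarith [abs_nonneg (X ω)]
    _ = _ := by rw [integral_add (integrable_const _) (hint.indicator hms)]; simp

/-- The Lindeberg estimate of the characteristic function of a centred random variable. -/
lemma norm_integral_cexp_sub_le {X : Ω → ℝ} (hX : Measurable X) (h2 : MemLp X 2 μ)
    (h0 : ∫ ω, X ω ∂μ = 0) {δ : ℝ} (hδ : 0 < δ) (hδ1 : δ ≤ 1) :
    ‖∫ ω, Complex.exp (X ω * Complex.I) ∂μ - Complex.exp (-((∫ ω, X ω ^ 2 ∂μ) / 2 : ℝ))‖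
      ≤ δ * (∫ ω, X ω ^ 2 ∂μ) + 3 * (∫ ω in {ω | δ ≤ |X ω|}, X ω ^ 2 ∂μ)
        + (∫ ω, X ω ^ 2 ∂μ) * (δ ^ 2 + ∫ ω in {ω | δ ≤ |X ω|}, X ω ^ 2 ∂μ) := by
  have hms : MeasurableSet {ω | δ ≤ |X ω|} := measurableSet_le measurable_const hX.abs
  have hint : Integrable (fun ω => X ω ^ 2) μ := h2.integrable_sq
  have hint1 : Integrable X μ := h2.integrable one_le_two
  set v := ∫ ω, X ω ^ 2 ∂μ with hv
  have hv0 : 0 ≤ v := integral_nonneg fun ω => sq_nonneg _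
  have hsmall := integral_sq_le_sq_add_setIntegral hX h2 hδ
  have hT : Integrable (fun ω => (1 + X ω * Complex.I - (X ω : ℂ) ^ 2 / 2 : ℂ)) μ := by
    refine ((integrable_const _).add (hint1.ofReal.mul_const _)).sub ?_
    have := (hint.ofReal (𝕜 := ℂ)).div_const 2
    simpa using this
  have hE : Integrable (fun ω => Complex.exp (X ω * Complex.I)) μ := by
    refine Integrable.of_bound (by fun_prop) 1 (ae_of_all _ fun ω => ?_)
    rw [Complex.norm_exp_ofReal_mul_I]
  have hTi : ∫ ω, (1 + X ω * Complex.I - (X ω : ℂ) ^ 2 / 2 : ℂ) ∂μ = 1 - ((v / 2 : ℝ) : ℂ) := by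
    have e1 : Integrable (fun ω => (X ω : ℂ) ^ 2 / 2) μ := by
      have := (hint.ofReal (𝕜 := ℂ)).div_const 2
      simpa using this
    have e2 : Integrable (fun ω => (X ω : ℂ) * Complex.I) μ := hint1.ofReal.mul_const _
    have e3 : Integrable (fun ω => 1 + (X ω : ℂ) * Complex.I) μ := (integrable_const _).add e2
    rw [integral_sub e3 e1, integral_add (integrable_const _) e2,
      integral_mul_const, integral_complex_ofReal, h0, integral_div]
    have : ∫ ω, (X ω : ℂ) ^ 2 ∂μ = ((v : ℝ) : ℂ) := by
      rw [hv, ← integral_complex_ofReal]; simp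
    rw [this]
    simp
  have hA : ‖∫ ω, Complex.exp (X ω * Complex.I) ∂μ - (1 - ((v / 2 : ℝ) : ℂ))‖
      ≤ δ * v + 3 * ∫ ω in {ω | δ ≤ |X ω|}, X ω ^ 2 ∂μ := by
    rw [← hTi, ← integral_sub hE hT]
    refine (norm_integral_le_integral_norm _).trans ?_
    rw [hv, ← integral_indicator hms, ← integral_const_mul, ← integral_const_mul,
      ← integral_add (hint.const_mul _) ((hint.indicator hms).const_mul _)]
    refine integral_mono (hE.sub hT).norm
      ((hint.const_mul _).add ((hint.indicator hms).const_mul _)) fun ω => ?_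
    by_cases hω : ω ∈ {ω | δ ≤ |X ω|}
    · simp only [Set.indicator_of_mem hω]
      have := norm_cexp_mul_I_sub_taylor_le_sq (X ω)
      nlinarith [mul_nonneg hδ.le (sq_nonneg (X ω))]
    · simp only [Set.indicator_of_notMem hω]
      have hlt : |X ω| < δ := not_le.1 hω
      have := norm_cexp_mul_I_sub_taylor_le_cube (x := X ω) (by linarith)
      refine this.trans ?_
      rw [← sq_abs (X ω)]
      nlinarith [mul_nonneg (sub_nonneg.2 hlt.le) (sq_nonneg |X ω|)]
  have hB := norm_cexp_neg_sub_one_sub_le (y := v / 2) (by positivity)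
  rw [norm_sub_rev] at hB
  have htri := norm_sub_le_norm_sub_add_norm_sub (∫ ω, Complex.exp (X ω * Complex.I) ∂μ)
    (1 - ((v / 2 : ℝ) : ℂ)) (Complex.exp (-((v / 2 : ℝ) : ℂ)))
  have hC : (v / 2) ^ 2 ≤ v * (δ ^ 2 + ∫ ω in {ω | δ ≤ |X ω|}, X ω ^ 2 ∂μ) := by
    have := mul_le_mul_of_nonneg_left hsmall hv0
    nlinarith [sq_nonneg v]
  linarith

/-- **Lindeberg's theorem** for a triangular array, in terms of characteristic functions. -/
theorem tendsto_integral_cexp_sum_of_lindeberg {X : ℕ → ℕ → Ω → ℝ}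
    (hm : ∀ n i, Measurable (X n i)) (hind : ∀ n, iIndepFun (X n) μ)
    (h2 : ∀ n i, MemLp (X n i) 2 μ) (h0 : ∀ n i, ∫ ω, X n i ω ∂μ = 0) {v : ℝ}
    (hv : Tendsto (fun n => ∑ i ∈ Finset.range n, ∫ ω, X n i ω ^ 2 ∂μ) atTop (𝓝 v))
    (hL : ∀ δ : ℝ, 0 < δ → Tendsto (fun n => ∑ i ∈ Finset.range n,
      ∫ ω in {ω | δ ≤ |X n i ω|}, X n i ω ^ 2 ∂μ) atTop (𝓝 0)) :
    Tendsto (fun n => ∫ ω, Complex.exp ((∑ i ∈ Finset.range n, X n i ω : ℝ) * Complex.I) ∂μ)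
      atTop (𝓝 (Complex.exp (-(v / 2 : ℝ)))) := by
  have hprod : ∀ n, ∫ ω, Complex.exp ((∑ i ∈ Finset.range n, X n i ω : ℝ) * Complex.I) ∂μ
      = ∏ i ∈ Finset.range n, ∫ ω, Complex.exp (X n i ω * Complex.I) ∂μ := by
    intro n
    have h := iIndepFun.charFun_map_fun_finsetSum_eq_prod (P := μ) (s := Finset.range n)
      (X := X n) (fun i _ => (hm n i).aemeasurable) ((hind n).restrict _)
    have h1 := congrFun h 1
    rw [Finset.prod_apply, charFun_apply_real, integral_map (by fun_prop) (by fun_prop)] at h1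
    simp only [Complex.ofReal_one, one_mul] at h1
    rw [h1]
    refine Finset.prod_congr rfl fun i _ => ?_
    rw [charFun_apply_real, integral_map (by fun_prop) (by fun_prop)]
    simp
  set V : ℕ → ℝ := fun n => ∑ i ∈ Finset.range n, ∫ ω, X n i ω ^ 2 ∂μ with hV
  set ℓ : ℝ → ℕ → ℝ := fun δ n => ∑ i ∈ Finset.range n,
    ∫ ω in {ω | δ ≤ |X n i ω|}, X n i ω ^ 2 ∂μ with hℓ
  have hbound : ∀ δ : ℝ, 0 < δ → δ ≤ 1 → ∀ n,
      ‖∫ ω, Complex.exp ((∑ i ∈ Finset.range n, X n i ω : ℝ) * Complex.I) ∂μ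
        - Complex.exp (-(V n / 2 : ℝ))‖ ≤ δ * V n + 3 * ℓ δ n + V n * (δ ^ 2 + ℓ δ n) := by
    intro δ hδ hδ1 n
    have hexp : Complex.exp (-(V n / 2 : ℝ))
        = ∏ i ∈ Finset.range n, Complex.exp (-((∫ ω, X n i ω ^ 2 ∂μ) / 2 : ℝ)) := by
      rw [← Complex.exp_sum, hV]
      congr 1
      push_cast
      rw [Finset.sum_neg_distrib, Finset.sum_div]
    rw [hprod, hexp]
    refine (norm_prod_sub_prod_le_sum _ _ _ (fun i _ => ?_) (fun i _ => ?_)).trans ?_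
    · refine (norm_integral_le_integral_norm _).trans ?_
      simp [Complex.norm_exp_ofReal_mul_I]
    · rw [← Complex.ofReal_neg, ← Complex.ofReal_exp, Complex.norm_real, Real.norm_eq_abs,
        Real.abs_exp, Real.exp_le_one_iff]
      have : 0 ≤ ∫ ω, X n i ω ^ 2 ∂μ := integral_nonneg fun ω => sq_nonneg _
      linarith
    · calc _ ≤ ∑ i ∈ Finset.range n, (δ * (∫ ω, X n i ω ^ 2 ∂μ)
            + 3 * (∫ ω in {ω | δ ≤ |X n i ω|}, X n i ω ^ 2 ∂μ)
            + (∫ ω, X n i ω ^ 2 ∂μ) * (δ ^ 2 + ℓ δ n)) := by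
            refine Finset.sum_le_sum fun i hi => ?_
            refine (norm_integral_cexp_sub_le (hm n i) (h2 n i) (h0 n i) hδ hδ1).trans ?_
            have hnn : ∀ j, 0 ≤ ∫ ω in {ω | δ ≤ |X n j ω|}, X n j ω ^ 2 ∂μ :=
              fun j => integral_nonneg fun ω => sq_nonneg _
            gcongr
            exact Finset.single_le_sum
                (f := fun j => ∫ ω in {ω | δ ≤ |X n j ω|}, X n j ω ^ 2 ∂μ)
                (fun j _ => hnn j) hi
        _ = _ := by
            rw [Finset.sum_add_distrib, Finset.sum_add_distrib, ← Finset.mul_sum,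
              ← Finset.mul_sum, ← Finset.sum_mul]
  have hdiff : Tendsto (fun n => ∫ ω, Complex.exp ((∑ i ∈ Finset.range n, X n i ω : ℝ)
      * Complex.I) ∂μ - Complex.exp (-(V n / 2 : ℝ))) atTop (𝓝 0) := by
    rw [tendsto_zero_iff_norm_tendsto_zero, Metric.tendsto_nhds]
    intro ε hε
    -- The bound has limit `δv + vδ²` as `n → ∞` with `δ` fixed; `δ` is chosen first to bring this
    -- below `ε`.
    have hlim0 : Tendsto (fun δ : ℝ => δ * v + 3 * 0 + v * (δ ^ 2 + 0)) (𝓝[>] 0) (𝓝 0) := by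
      have : Continuous fun δ : ℝ => δ * v + 3 * 0 + v * (δ ^ 2 + 0) := by fun_prop
      have h := this.tendsto 0
      simp only [zero_mul, mul_zero, add_zero, ne_eq, OfNat.ofNat_ne_zero, not_false_eq_true,
        zero_pow] at h ⊢
      exact h.mono_left nhdsWithin_le_nhds
    obtain ⟨δ, hδε, hδ, hδ1⟩ := ((hlim0.eventually_lt_const hε).and
      (Ioc_mem_nhdsGT (zero_lt_one (α := ℝ)))).exists
    have hn : Tendsto (fun n => δ * V n + 3 * ℓ δ n + V n * (δ ^ 2 + ℓ δ n)) atTop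
        (𝓝 (δ * v + 3 * 0 + v * (δ ^ 2 + 0))) :=
      ((hv.const_mul δ).add ((hL δ hδ).const_mul 3)).add
        (hv.mul ((hL δ hδ).const_add (δ ^ 2)))
    filter_upwards [hn.eventually_lt_const hδε] with n hnε
    rw [Real.dist_eq, sub_zero, abs_of_nonneg (norm_nonneg _)]
    exact (hbound δ hδ hδ1 n).trans_lt hnε
  have hexpV : Tendsto (fun n => Complex.exp (-(V n / 2 : ℝ))) atTop
      (𝓝 (Complex.exp (-(v / 2 : ℝ)))) := by
    have hc : Continuous fun x : ℝ => Complex.exp (-(x / 2 : ℝ)) := by fun_prop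
    exact (hc.tendsto v).comp hv
  simpa using hdiff.add hexpV

end LindebergScalar

/-! ### Matrices acting on Euclidean space, and square roots. -/

section MatrixAction

variable {p : ℕ}

lemma act_apply (M : Matrix (Fin p) (Fin p) ℝ) (x : E p) (a : Fin p) :
    act M x a = ∑ b, M a b * x b := by
  simp [act, Matrix.ofLp_toEuclideanCLM, Matrix.mulVec, dotProduct]

lemma act_mul (M N : Matrix (Fin p) (Fin p) ℝ) (x : E p) : act (M * N) x = act M (act N x) := by
  simp [act, map_mul]

@[simp] lemma act_one (x : E p) : act 1 x = x := by
  simp [act]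

lemma act_neg (M : Matrix (Fin p) (Fin p) ℝ) (x : E p) : act M (-x) = -act M x :=
  map_neg (Matrix.toEuclideanCLM (𝕜 := ℝ) M) x

lemma act_sum_right {ι : Type*} (s : Finset ι) (M : Matrix (Fin p) (Fin p) ℝ) (x : ι → E p) :
    act M (∑ i ∈ s, x i) = ∑ i ∈ s, act M (x i) :=
  map_sum (Matrix.toEuclideanCLM (𝕜 := ℝ) M) x s

lemma act_sum_left {ι : Type*} (s : Finset ι) (M : ι → Matrix (Fin p) (Fin p) ℝ) (x : E p) :
    act (∑ i ∈ s, M i) x = ∑ i ∈ s, act (M i) x := by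
  simp [act, map_sum]

lemma act_smul_one (c : ℝ) (x : E p) : act (c • (1 : Matrix (Fin p) (Fin p) ℝ)) x = c • x := by
  simp [act]

@[fun_prop] lemma continuous_act (M : Matrix (Fin p) (Fin p) ℝ) : Continuous (act M) :=
  (Matrix.toEuclideanCLM (𝕜 := ℝ) M).continuous

@[fun_prop] lemma measurable_act (M : Matrix (Fin p) (Fin p) ℝ) : Measurable (act M) :=
  (continuous_act M).measurable

lemma inner_act_eq_sum (M : Matrix (Fin p) (Fin p) ℝ) (x y : E p) :
    inner ℝ x (act M y) = ∑ a, ∑ b, x a * M a b * y b := by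
  simp only [PiLp.inner_apply, act_apply, RCLike.inner_apply, conj_trivial, Finset.sum_mul]
  refine Finset.sum_congr rfl fun a _ => Finset.sum_congr rfl fun b _ => by ring

lemma inner_act_left (M : Matrix (Fin p) (Fin p) ℝ) (x y : E p) :
    inner ℝ (act M x) y = inner ℝ x (act Mᵀ y) := by
  rw [real_inner_comm, inner_act_eq_sum, inner_act_eq_sum, Finset.sum_comm]
  refine Finset.sum_congr rfl fun a _ => Finset.sum_congr rfl fun b _ => ?_
  rw [Matrix.transpose_apply]; ring

lemma inner_act_eq_dotProduct (M : Matrix (Fin p) (Fin p) ℝ) (x y : E p) :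
    inner ℝ x (act M y) = x ⬝ᵥ M *ᵥ y := by
  rw [inner_act_eq_sum]
  simp [dotProduct, Matrix.mulVec, Finset.mul_sum, mul_assoc]

lemma inner_act_single (M : Matrix (Fin p) (Fin p) ℝ) (a : Fin p) :
    inner ℝ (EuclideanSpace.single a (1 : ℝ)) (act M (EuclideanSpace.single a 1)) = M a a := by
  rw [inner_act_eq_sum]
  simp [Finset.sum_ite_eq']

lemma tendsto_inner_act {ι : Type*} {l : Filter ι} {M : ι → Matrix (Fin p) (Fin p) ℝ}
    {M₀ : Matrix (Fin p) (Fin p) ℝ} (h : Tendsto M l (𝓝 M₀)) (x y : E p) :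
    Tendsto (fun i => inner ℝ x (act (M i) y)) l (𝓝 (inner ℝ x (act M₀ y))) := by
  simp only [inner_act_eq_sum]
  refine tendsto_finsetSum _ fun a _ => tendsto_finsetSum _ fun b _ => ?_
  have hab : Tendsto (fun i => M i a b) l (𝓝 (M₀ a b)) :=
    ((continuous_apply_apply a b).tendsto M₀).comp h
  exact (hab.const_mul _).mul_const _

lemma transpose_eq_of_posSemidef {M : Matrix (Fin p) (Fin p) ℝ} (hM : M.PosSemidef) : Mᵀ = M := by
  have := hM.isHermitian
  rwa [Matrix.IsHermitian, Matrix.conjTranspose_eq_transpose_of_trivial] at this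

lemma posSemidef_of_transpose_eq_of_inner_nonneg {M : Matrix (Fin p) (Fin p) ℝ} (h : Mᵀ = M)
    (hn : ∀ x : E p, 0 ≤ inner ℝ x (act M x)) : M.PosSemidef := by
  refine Matrix.PosSemidef.of_dotProduct_mulVec_nonneg ?_ fun x => ?_
  · rwa [Matrix.IsHermitian, Matrix.conjTranspose_eq_transpose_of_trivial]
  · have := hn (WithLp.toLp 2 x)
    rwa [inner_act_eq_dotProduct] at this

lemma inner_act_self_nonneg {M : Matrix (Fin p) (Fin p) ℝ} (hM : M.PosSemidef) (x : E p) :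
    0 ≤ inner ℝ x (act M x) := by
  rw [inner_act_eq_dotProduct]
  exact hM.dotProduct_mulVec_nonneg _

/-- Symmetry and nonnegativity are closed conditions. The limit covariances obtain their positive
semidefiniteness in this way. -/
lemma posSemidef_of_tendsto {M : ℕ → Matrix (Fin p) (Fin p) ℝ} {M₀ : Matrix (Fin p) (Fin p) ℝ}
    (hM : ∀ᶠ n in atTop, (M n).PosSemidef) (h : Tendsto M atTop (𝓝 M₀)) : M₀.PosSemidef := by
  refine posSemidef_of_transpose_eq_of_inner_nonneg ?_ fun x => ?_
  · refine tendsto_nhds_unique (f := M) (l := atTop) ?_ h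
    have h1 : Tendsto (fun n => (M n)ᵀ) atTop (𝓝 M₀ᵀ) :=
      ((continuous_id.matrix_transpose).tendsto M₀).comp h
    refine h1.congr' ?_
    filter_upwards [hM] with n hn using transpose_eq_of_posSemidef hn
  · refine ge_of_tendsto (tendsto_inner_act h x x) ?_
    filter_upwards [hM] with n hn using inner_act_self_nonneg hn x

lemma posSemidef_rt (M : Matrix (Fin p) (Fin p) ℝ) : (rt M).PosSemidef :=
  (CFC.sqrt_nonneg M).posSemidef

@[simp] lemma transpose_rt (M : Matrix (Fin p) (Fin p) ℝ) : (rt M)ᵀ = rt M :=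
  transpose_eq_of_posSemidef (posSemidef_rt M)

@[simp] lemma transpose_invRt (M : Matrix (Fin p) (Fin p) ℝ) : (invRt M)ᵀ = invRt M := by
  rw [invRt, Matrix.transpose_nonsing_inv, transpose_rt]

lemma rt_mul_rt {M : Matrix (Fin p) (Fin p) ℝ} (hM : M.PosSemidef) : rt M * rt M = M :=
  CFC.sqrt_mul_sqrt_self M hM.nonneg

lemma isUnit_det_rt {M : Matrix (Fin p) (Fin p) ℝ} (hM : M.PosDef) : IsUnit (rt M).det := by
  have h : (rt M).det * (rt M).det = M.det := by
    rw [← Matrix.det_mul, rt_mul_rt hM.posSemidef]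
  refine isUnit_iff_ne_zero.2 fun h0 => hM.det_pos.ne' ?_
  rw [← h, h0, zero_mul]

lemma invRt_mul_rt {M : Matrix (Fin p) (Fin p) ℝ} (hM : M.PosDef) : invRt M * rt M = 1 :=
  Matrix.nonsing_inv_mul _ (isUnit_det_rt hM)

lemma rt_mul_invRt {M : Matrix (Fin p) (Fin p) ℝ} (hM : M.PosDef) : rt M * invRt M = 1 :=
  Matrix.mul_nonsing_inv _ (isUnit_det_rt hM)

lemma invRt_mul_invRt {M : Matrix (Fin p) (Fin p) ℝ} (hM : M.PosDef) :
    invRt M * invRt M = M⁻¹ := by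
  rw [invRt, ← Matrix.mul_inv_rev, rt_mul_rt hM.posSemidef]

lemma invRt_mul_mul_invRt {M : Matrix (Fin p) (Fin p) ℝ} (hM : M.PosDef) :
    invRt M * M * invRt M = 1 := by
  nth_rewrite 2 [← rt_mul_rt hM.posSemidef]
  rw [← mul_assoc, invRt_mul_rt hM, one_mul, rt_mul_invRt hM]

/-- Here `⟨x, Mx⟩ = ‖M^{1/2}x‖²` and `‖x‖ ≤ C ‖M^{1/2}x‖`, with `C` the norm of `M^{-1/2}`. The `+
1` covers `p = 0`, where `C = 0`. -/
lemma exists_pos_mul_sq_norm_le_inner_act {M : Matrix (Fin p) (Fin p) ℝ} (hM : M.PosDef) :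
    ∃ c : ℝ, 0 < c ∧ ∀ x : E p, c * ‖x‖ ^ 2 ≤ inner ℝ x (act M x) := by
  set C := ‖Matrix.toEuclideanCLM (𝕜 := ℝ) (invRt M)‖ with hC
  refine ⟨(C ^ 2 + 1)⁻¹, by positivity, fun x => ?_⟩
  have h1 : inner ℝ x (act M x) = ‖act (rt M) x‖ ^ 2 := by
    rw [← real_inner_self_eq_norm_sq, inner_act_left, transpose_rt, ← act_mul,
      rt_mul_rt hM.posSemidef]
  have h2 : ‖x‖ ≤ C * ‖act (rt M) x‖ := by
    have : x = act (invRt M) (act (rt M) x) := by rw [← act_mul, invRt_mul_rt hM, act_one]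
    calc ‖x‖ = ‖act (invRt M) (act (rt M) x)‖ := by rw [← this]
      _ ≤ _ := ContinuousLinearMap.le_opNorm _ _
  rw [h1, inv_mul_le_iff₀ (by positivity)]
  have h3 : ‖x‖ ^ 2 ≤ (C * ‖act (rt M) x‖) ^ 2 := by gcongr
  nlinarith [sq_nonneg ‖act (rt M) x‖]

lemma posSemidef_mul_mul_self {L K : Matrix (Fin p) (Fin p) ℝ} (hL : Lᵀ = L)
    (hK : K.PosSemidef) : (L * K * L).PosSemidef := by
  have := hK.mul_mul_conjTranspose_same L
  rwa [Matrix.conjTranspose_eq_transpose_of_trivial, hL] at this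

/-- `J⁻¹K` need not be symmetric, but it has the same trace as the positive semidefinite
`J^{-1/2}KJ^{-1/2}`, and that trace dominates each diagonal entry. -/
lemma diag_invRt_mul_mul_invRt_le {J K : Matrix (Fin p) (Fin p) ℝ} (hJ : J.PosDef)
    (hK : K.PosSemidef) {C : ℝ} (hC : ∀ a b, |(J⁻¹ * K) a b| ≤ C) (a : Fin p) :
    (invRt J * K * invRt J) a a ≤ p * C := by
  have hps := posSemidef_mul_mul_self (transpose_invRt J) hK
  calc (invRt J * K * invRt J) a a ≤ (invRt J * K * invRt J).trace :=
        Finset.single_le_sum (f := fun a => (invRt J * K * invRt J) a a)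
          (fun b _ => hps.diag_nonneg) (Finset.mem_univ a)
    _ = (J⁻¹ * K).trace := by
        rw [Matrix.trace_mul_comm, ← mul_assoc, invRt_mul_invRt hJ]
    _ ≤ ∑ _a : Fin p, C := Finset.sum_le_sum fun b _ => (le_abs_self _).trans (hC b b)
    _ = p * C := by simp

end MatrixAction

/-! ### First and second moments of the sums of the `D_i(Y_i)`. -/

section Moments

variable {Ω : Type*} [MeasurableSpace Ω] {p : ℕ} {𝓨 : ℕ → Type*} {Y : ∀ i, Ω → 𝓨 i}
  {D : ∀ i, 𝓨 i → E p}

lemma memLp_Dsum {μ : Measure Ω} (hD2 : ∀ i, MemLp (fun ω => D i (Y i ω)) 2 μ) (n : ℕ) :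
    MemLp (Dsum Y D n) 2 μ := by
  have := memLp_finsetSum (Finset.range n) fun i _ => hD2 i
  exact this

variable {μ : Measure Ω} [IsProbabilityMeasure μ]

lemma integral_inner_eq_zero {X : Ω → E p} (hX : MemLp X 2 μ) (h0 : ∫ ω, X ω ∂μ = 0) (s : E p) :
    ∫ ω, inner ℝ s (X ω) ∂μ = 0 := by
  rw [integral_inner (hX.integrable one_le_two), h0, inner_zero_right]

lemma variance_inner {X : Ω → E p} (hX : MemLp X 2 μ) (s : E p) :
    Var[fun ω => inner ℝ s (X ω); μ] = inner ℝ s (act (varMatrix μ X) s) := by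
  have hc : ∀ a, MemLp (fun ω => s a * X ω a) 2 μ := fun a =>
    (MemLp.eval_piLp hX a).const_mul (s a)
  have he : (fun ω => inner ℝ s (X ω)) = fun ω => ∑ a, s a * X ω a := by
    ext ω
    simp only [PiLp.inner_apply, RCLike.inner_apply, conj_trivial]
    exact Finset.sum_congr rfl fun a _ => mul_comm _ _
  rw [he, variance_fun_sum hc, inner_act_eq_sum]
  refine Finset.sum_congr rfl fun a _ => Finset.sum_congr rfl fun b _ => ?_
  rw [covariance_const_mul_left, covariance_const_mul_right, varMatrix, Matrix.of_apply]
  ring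

lemma posSemidef_varMatrix {X : Ω → E p} (hX : MemLp X 2 μ) : (varMatrix μ X).PosSemidef := by
  refine posSemidef_of_transpose_eq_of_inner_nonneg ?_ fun s => ?_
  · ext a b
    simp [varMatrix, covariance_comm]
  · rw [← variance_inner hX]
    exact variance_nonneg _ _

lemma posSemidef_Ksum (hD2 : ∀ i, MemLp (fun ω => D i (Y i ω)) 2 μ) (n : ℕ) :
    (Ksum μ Y D n).PosSemidef :=
  Matrix.posSemidef_sum _ fun i _ => posSemidef_varMatrix (hD2 i)

lemma inner_act_Ksum (hD2 : ∀ i, MemLp (fun ω => D i (Y i ω)) 2 μ) (n : ℕ) (s : E p) :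
    inner ℝ s (act (Ksum μ Y D n) s)
      = ∑ i ∈ Finset.range n, Var[fun ω => inner ℝ s (D i (Y i ω)); μ] := by
  rw [Ksum, act_sum_left, inner_sum]
  exact Finset.sum_congr rfl fun i _ => (variance_inner (hD2 i) s).symm

variable [∀ i, MeasurableSpace (𝓨 i)]

lemma measurable_Dsum (hY : ∀ i, Measurable (Y i)) (hDm : ∀ i, Measurable (D i)) (n : ℕ) :
    Measurable (Dsum Y D n) :=
  Finset.measurable_sum _ fun i _ => (hDm i).comp (hY i)

lemma integral_sq_inner_Dsum (hindep : iIndepFun Y μ)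
    (hDm : ∀ i, Measurable (D i)) (hD2 : ∀ i, MemLp (fun ω => D i (Y i ω)) 2 μ)
    (hD0 : ∀ i, ∫ ω, D i (Y i ω) ∂μ = 0) (n : ℕ) (s : E p) :
    ∫ ω, inner ℝ s (Dsum Y D n ω) ^ 2 ∂μ = inner ℝ s (act (Ksum μ Y D n) s) := by
  have hsum : (fun ω => inner ℝ s (Dsum Y D n ω))
      = ∑ i ∈ Finset.range n, fun ω => inner ℝ s (D i (Y i ω)) := by
    ext ω; simp [Dsum, inner_sum]
  have h0 : ∫ ω, inner ℝ s (Dsum Y D n ω) ∂μ = 0 := by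
    simp only [Dsum, inner_sum]
    rw [integral_finsetSum _ fun i _ => ((hD2 i).const_inner s).integrable one_le_two]
    exact Finset.sum_eq_zero fun i _ => integral_inner_eq_zero (hD2 i) (hD0 i) s
  rw [← variance_of_integral_eq_zero ((memLp_Dsum hD2 n).const_inner s).aemeasurable h0, hsum,
    IndepFun.variance_sum (fun i _ => (hD2 i).const_inner s), inner_act_Ksum hD2]
  intro i _ j _ hij
  exact (hindep.indepFun hij).comp (φ := fun y => inner ℝ s (D i y))
    (ψ := fun y => inner ℝ s (D j y)) (by fun_prop) (by fun_prop)

end Moments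

/-! ### Central limit theorem for normalised vector sums. -/

section CentralLimit

variable {Ω : Type*} [MeasurableSpace Ω] {μ : Measure Ω} {p : ℕ}

/-- Pointwise control of the truncated square of a linear form by those of the coordinates. -/
lemma indicator_sq_inner_le {C δ : ℝ} (hC : 0 < C) (hδ : 0 < δ) {t : E p} (ht : ‖t‖ ≤ C)
    (x : E p) :
    (if δ ≤ |inner ℝ t x| then inner ℝ t x ^ 2 else 0)
      ≤ (C * (p + 1)) ^ 2 * ∑ a, if δ / (C * (p + 1)) ≤ |x a| then x a ^ 2 else 0 := by
  have hnn : ∀ a, (0 : ℝ) ≤ if δ / (C * (p + 1)) ≤ |x a| then x a ^ 2 else 0 := fun a => by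
    split_ifs <;> positivity
  have hB : 0 < C * ((p : ℝ) + 1) := by positivity
  split_ifs with h
  swap
  · exact mul_nonneg (sq_nonneg _) (Finset.sum_nonneg fun a _ => hnn a)
  have hsum : |inner ℝ t x| ≤ C * ∑ a, |x a| := by
    rw [PiLp.inner_apply, Finset.mul_sum]
    refine (Finset.abs_sum_le_sum_abs _ _).trans (Finset.sum_le_sum fun a _ => ?_)
    simp only [RCLike.inner_apply, conj_trivial]
    rw [abs_mul, mul_comm]
    gcongr
    exact (PiLp.norm_apply_le t a).trans ht
  have hne : (Finset.univ : Finset (Fin p)).Nonempty := by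
    by_contra hemp
    rw [Finset.not_nonempty_iff_eq_empty] at hemp
    rw [hemp] at hsum
    simp only [Finset.sum_empty, mul_zero] at hsum
    linarith
  obtain ⟨b, -, hb⟩ := Finset.exists_max_image Finset.univ (fun a => |x a|) hne
  -- The largest coordinate controls the linear form, hence must itself exceed the reduced
  -- threshold. Using `p + 1` instead of `p` keeps the divisor positive when `p = 0`.
  have hle : |inner ℝ t x| ≤ C * (p + 1) * |x b| := by
    have h1 : ∑ a, |x a| ≤ ∑ _a : Fin p, |x b| := Finset.sum_le_sum fun a ha => hb a ha
    simp only [Finset.sum_const, Finset.card_univ, Fintype.card_fin, nsmul_eq_mul] at h1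
    have := mul_le_mul_of_nonneg_left h1 hC.le
    nlinarith [mul_nonneg hC.le (abs_nonneg (x b))]
  have hδb : δ / (C * (p + 1)) ≤ |x b| := by
    rw [div_le_iff₀ hB]; linarith
  calc inner ℝ t x ^ 2 = |inner ℝ t x| ^ 2 := (sq_abs _).symm
    _ ≤ (C * (p + 1) * |x b|) ^ 2 := by gcongr
    _ = (C * (p + 1)) ^ 2 * x b ^ 2 := by rw [mul_pow, sq_abs]
    _ ≤ _ := by
        gcongr
        have := Finset.single_le_sum
          (f := fun a => if δ / (C * (p + 1)) ≤ |x a| then x a ^ 2 else 0)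
          (fun a _ => hnn a) (Finset.mem_univ b)
        simpa only [if_pos hδb] using this

lemma setIntegral_abs_ge_eq {X : Ω → ℝ} (hX : Measurable X) (δ : ℝ) :
    ∫ ω in {ω | δ ≤ |X ω|}, X ω ^ 2 ∂μ = ∫ ω, (if δ ≤ |X ω| then X ω ^ 2 else 0) ∂μ := by
  have hms : MeasurableSet {ω | δ ≤ |X ω|} := measurableSet_le measurable_const hX.abs
  rw [← integral_indicator hms]
  rfl

lemma integrable_ite_sq {X : Ω → ℝ} (hX : Measurable X) (h2 : MemLp X 2 μ) (δ : ℝ) :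
    Integrable (fun ω => if δ ≤ |X ω| then X ω ^ 2 else 0) μ := by
  have hms : MeasurableSet {ω | δ ≤ |X ω|} := measurableSet_le measurable_const hX.abs
  exact h2.integrable_sq.indicator hms

/-- The Lindeberg conditions imply those for the linear forms with bounded coefficients, which
may depend on the row of the array. -/
lemma Lindeberg.tendsto_of_bounded {X : ℕ → ℕ → Ω → E p} (hL : Lindeberg μ X)
    (hm : ∀ n i, Measurable (X n i)) (h2 : ∀ n i, MemLp (X n i) 2 μ) {t : ℕ → E p} {C : ℝ}
    (hC : 0 < C) (ht : ∀ᶠ n in atTop, ‖t n‖ ≤ C) {δ : ℝ} (hδ : 0 < δ) :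
    Tendsto (fun n : ℕ => ∑ i ∈ Finset.range n,
      ∫ ω in {ω | δ ≤ |inner ℝ (t n) (X n i ω)|}, (inner ℝ (t n) (X n i ω)) ^ 2 ∂μ)
      atTop (𝓝 0) := by
  set δ' := δ / (C * (p + 1)) with hδ'
  have hδ'pos : 0 < δ' := by positivity
  have hlim : Tendsto (fun n : ℕ => (C * (p + 1)) ^ 2 * ∑ a : Fin p, ∑ i ∈ Finset.range n,
      ∫ ω in {ω | δ' ≤ |inner ℝ (EuclideanSpace.single a (1 : ℝ)) (X n i ω)|},
        (inner ℝ (EuclideanSpace.single a (1 : ℝ)) (X n i ω)) ^ 2 ∂μ) atTop (𝓝 0) := by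
    have := (tendsto_finsetSum (Finset.univ : Finset (Fin p)) fun a _ =>
      hL (EuclideanSpace.single a (1 : ℝ)) δ' hδ'pos).const_mul ((C * (p + 1)) ^ 2)
    simpa using this
  refine squeeze_zero' (Eventually.of_forall fun n => Finset.sum_nonneg fun i _ =>
    integral_nonneg fun ω => sq_nonneg _) ?_ hlim
  filter_upwards [ht] with n hn
  rw [Finset.sum_comm, Finset.mul_sum]
  refine Finset.sum_le_sum fun i _ => ?_
  have hmc : ∀ a : Fin p, Measurable fun ω => X n i ω a := fun a =>
    (measurable_pi_apply a).comp ((WithLp.measurable_ofLp 2 _).comp (hm n i))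
  have h2c : ∀ a : Fin p, MemLp (fun ω => X n i ω a) 2 μ := fun a => MemLp.eval_piLp (h2 n i) a
  have hin : ∀ (a : Fin p) ω, inner ℝ (EuclideanSpace.single a (1 : ℝ)) (X n i ω) = X n i ω a := by
    intro a ω; simp [EuclideanSpace.inner_single_left]
  simp only [hin]
  rw [setIntegral_abs_ge_eq (measurable_const.inner (hm n i))]
  simp only [setIntegral_abs_ge_eq (hmc _)]
  rw [← integral_finsetSum _ fun a _ => integrable_ite_sq (hmc a) (h2c a) δ', ← integral_const_mul]
  refine integral_mono (integrable_ite_sq (measurable_const.inner (hm n i))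
    ((h2 n i).const_inner (t n)) δ) ((integrable_finsetSum _ fun a _ =>
      integrable_ite_sq (hmc a) (h2c a) δ').const_mul _) fun ω => ?_
  exact indicator_sq_inner_le hC hδ hn _

variable [IsProbabilityMeasure μ] {𝓨 : ℕ → Type*} [∀ i, MeasurableSpace (𝓨 i)]
  {Y : ∀ i, Ω → 𝓨 i} {D : ∀ i, 𝓨 i → E p}

/-- Convergence of the characteristic functions of normalised sums, along bounded sequences of
arguments. -/
lemma tendsto_integral_cexp_inner_act_Dsum (hY : ∀ i, Measurable (Y i)) (hindep : iIndepFun Y μ)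
    (hDm : ∀ i, Measurable (D i)) (hD2 : ∀ i, MemLp (fun ω => D i (Y i ω)) 2 μ)
    (hD0 : ∀ i, ∫ ω, D i (Y i ω) ∂μ = 0) {L : ℕ → Matrix (Fin p) (Fin p) ℝ}
    (hL : Lindeberg μ (fun n i ω => act (L n) (D i (Y i ω)))) (hLt : ∀ n, (L n)ᵀ = L n)
    {t : ℕ → E p} {C : ℝ} (ht : ∀ᶠ n in atTop, ‖t n‖ ≤ C) {v : ℝ}
    (hv : Tendsto (fun n => inner ℝ (t n) (act (L n * Ksum μ Y D n * L n) (t n))) atTop (𝓝 v)) :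
    Tendsto (fun n => ∫ ω, Complex.exp (inner ℝ (t n) (act (L n) (Dsum Y D n ω)) * Complex.I) ∂μ)
      atTop (𝓝 (Complex.exp (-(v / 2 : ℝ)))) := by
  have hX : ∀ n i, Measurable fun ω => act (L n) (D i (Y i ω)) := fun n i =>
    (measurable_act _).comp ((hDm i).comp (hY i))
  have hX2 : ∀ n i, MemLp (fun ω => act (L n) (D i (Y i ω))) 2 μ := fun n i =>
    (Matrix.toEuclideanCLM (𝕜 := ℝ) (L n)).comp_memLp' (hD2 i)
  have hswap : ∀ n x, inner ℝ (t n) (act (L n) x) = inner ℝ (act (L n) (t n)) x := fun n x => by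
    rw [inner_act_left, hLt]
  have hzero : ∀ n i, ∫ ω, inner ℝ (t n) (act (L n) (D i (Y i ω))) ∂μ = 0 := fun n i => by
    simp only [hswap]
    exact integral_inner_eq_zero (hD2 i) (hD0 i) _
  have hC : ∀ᶠ n in atTop, ‖t n‖ ≤ |C| + 1 := by
    filter_upwards [ht] with n hn
    linarith [le_abs_self C]
  have key := tendsto_integral_cexp_sum_of_lindeberg (μ := μ)
    (X := fun n i ω => inner ℝ (t n) (act (L n) (D i (Y i ω))))
    (fun n i => measurable_const.inner (hX n i))
    (fun n => hindep.comp (fun i y => inner ℝ (t n) (act (L n) (D i y))) fun i =>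
      measurable_const.inner ((measurable_act _).comp (hDm i)))
    (fun n i => (hX2 n i).const_inner _) hzero (v := v) ?_
    (fun δ hδ => hL.tendsto_of_bounded hX hX2 (by positivity) hC hδ)
  · refine key.congr fun n => integral_congr_ae (ae_of_all _ fun ω => ?_)
    simp only [Dsum, act_sum_right, inner_sum]
  · refine hv.congr fun n => ?_
    have h1 : inner ℝ (t n) (act (L n * Ksum μ Y D n * L n) (t n))
        = inner ℝ (act (L n) (t n)) (act (Ksum μ Y D n) (act (L n) (t n))) := by
      rw [act_mul, act_mul, hswap]
    rw [h1, inner_act_Ksum hD2]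
    refine Finset.sum_congr rfl fun i _ => ?_
    simp only [hswap]
    exact variance_of_integral_eq_zero ((hD2 i).const_inner _).aemeasurable
      (integral_inner_eq_zero (hD2 i) (hD0 i) _)

/-- Lévy's continuity theorem with a centred Gaussian limit. -/
lemma tendstoInDistribution_multivariateGaussian {Z : ℕ → Ω → E p}
    (hZ : ∀ n, AEMeasurable (Z n) μ) {S : Matrix (Fin p) (Fin p) ℝ} (hS : S.PosSemidef)
    (h : ∀ s : E p, Tendsto (fun n => ∫ ω, Complex.exp (inner ℝ s (Z n ω) * Complex.I) ∂μ) atTop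
      (𝓝 (Complex.exp (-(inner ℝ s (act S s) / 2 : ℝ))))) :
    TendstoInDistribution Z atTop id (fun _ => μ) (multivariateGaussian 0 S) where
  forall_aemeasurable := hZ
  aemeasurable_limit := aemeasurable_id
  tendsto := by
    refine ProbabilityMeasure.tendsto_iff_tendsto_charFun.2 fun s => ?_
    have h1 : charFun ((multivariateGaussian 0 S).map id) s
        = Complex.exp (-(inner ℝ s (act S s) / 2 : ℝ)) := by
      rw [Measure.map_id, charFun_multivariateGaussian hS, inner_act_eq_dotProduct]
      simp
    have h2 : ∀ n, charFun (μ.map (Z n)) s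
        = ∫ ω, Complex.exp (inner ℝ s (Z n ω) * Complex.I) ∂μ := fun n => by
      rw [charFun_apply, integral_map (hZ n) (by fun_prop)]
      simp only [real_inner_comm]
    simp only [ProbabilityMeasure.coe_mk, h1, h2]
    exact h s

end CentralLimit

/-! ### Linear expansion of the normalised minimisers. -/

section LinearExpansion

variable {Ω : Type*} [MeasurableSpace Ω] {μ : Measure Ω}

/-- Chebyshev's inequality: half of the threshold is spent on the deviation from the mean, half on
the distance of the mean from `c n`. -/
lemma tendstoInMeasure_sub_of_variance_tendsto_zero {X : ℕ → Ω → ℝ} {c : ℕ → ℝ}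
    (hX : ∀ᶠ n in atTop, MemLp (X n) 2 μ)
    (hv : Tendsto (fun n => evariance (X n) μ) atTop (𝓝 0))
    (hc : Tendsto (fun n => (∫ ω, X n ω ∂μ) - c n) atTop (𝓝 0)) :
    TendstoInMeasure μ (fun n ω => X n ω - c n) atTop fun _ => 0 := by
  rw [tendstoInMeasure_iff_norm]
  intro η hη
  have hη2 : (η / 2).toNNReal ≠ 0 := by simp [hη]
  have hlim : Tendsto (fun n => evariance (X n) μ / ((η / 2).toNNReal : ℝ≥0∞) ^ 2) atTop
      (𝓝 0) := by
    have := ENNReal.Tendsto.div_const hv (b := ((η / 2).toNNReal : ℝ≥0∞) ^ 2)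
      (Or.inr (by simp [hη]))
    simpa using this
  refine tendsto_of_tendsto_of_tendsto_of_le_of_le' tendsto_const_nhds hlim
    (Eventually.of_forall fun _ => zero_le) ?_
  have hsmall : ∀ᶠ n in atTop, |(∫ ω, X n ω ∂μ) - c n| < η / 2 := by
    have := (Metric.tendsto_nhds.1 hc) (η / 2) (by positivity)
    simpa [Real.dist_eq] using this
  filter_upwards [hX, hsmall] with n hXn hn
  refine le_trans (measure_mono fun ω hω => ?_)
    (meas_ge_le_evariance_div_sq hXn.aestronglyMeasurable hη2)
  simp only [Set.mem_ofPred_eq, sub_zero, Real.norm_eq_abs] at hω ⊢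
  rw [Real.coe_toNNReal _ (by positivity)]
  have : X n ω - c n = (X n ω - ∫ ω, X n ω ∂μ) + ((∫ ω, X n ω ∂μ) - c n) := by ring
  rw [this] at hω
  have h3 := abs_add_le (X n ω - ∫ ω, X n ω ∂μ) ((∫ ω, X n ω ∂μ) - c n)
  linarith

variable [IsProbabilityMeasure μ] {p : ℕ}
  {𝓨 : ℕ → Type*} [∀ i, MeasurableSpace (𝓨 i)] {Y : ∀ i, Ω → 𝓨 i} {D : ∀ i, 𝓨 i → E p}

/-- The sum of the remainders is close to the quadratic term. -/
lemma tendstoInMeasure_sum_rem_sub (hY : ∀ i, Measurable (Y i)) (hindep : iIndepFun Y μ)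
    {Θ : Set (E p)} {θ₀ : E p} (hθ₀ : θ₀ ∈ Θ)
    {g : ∀ i, 𝓨 i → E p → ℝ} (hgm : ∀ i, ∀ θ ∈ Θ, Measurable fun y => g i y θ)
    (hDm : ∀ i, Measurable (D i)) {A : ℕ → Matrix (Fin p) (Fin p) ℝ} {t : ℕ → E p} {c : ℝ}
    (ht : ∀ᶠ n in atTop, θ₀ + t n ∈ Θ)
    (hmean : Tendsto (fun n : ℕ => ∑ i ∈ Finset.range n, meanErr μ Y g θ₀ D A i (t n))
      atTop (𝓝 0))
    (hvar : Tendsto (fun n : ℕ => ∑ i ∈ Finset.range n, remVar μ Y g θ₀ D i (t n))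
      atTop (𝓝 0))
    (hJ : Tendsto (fun n => inner ℝ (t n) (act (Jsum A n) (t n))) atTop (𝓝 c)) :
    TendstoInMeasure μ (fun n ω => ∑ i ∈ Finset.range n, rem g θ₀ D i (Y i ω) (t n)
      - 1 / 2 * c) atTop fun _ => 0 := by
  have hfin : ∀ᶠ n in atTop, ∑ i ∈ Finset.range n, remVar μ Y g θ₀ D i (t n) < ∞ :=
    hvar.eventually_lt_const (by simp)
  have hrm : ∀ n i, θ₀ + t n ∈ Θ → Measurable fun y => rem g θ₀ D i y (t n) := fun n i hn =>
    ((hgm i _ hn).sub (hgm i _ hθ₀)).sub ((hDm i).inner measurable_const)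
  -- The sum of extended variances tends to zero, so it is eventually finite; each remainder in the
  -- row is then square integrable.
  have h2 : ∀ᶠ n in atTop, ∀ i ∈ Finset.range n,
      MemLp (fun ω => rem g θ₀ D i (Y i ω) (t n)) 2 μ := by
    filter_upwards [hfin, ht] with n hn htn i hi
    exact (evariance_lt_top_iff_memLp
      ((hrm n i htn).comp (hY i)).aestronglyMeasurable).1 ((ENNReal.sum_lt_top.1 hn) i hi)
  refine tendstoInMeasure_sub_of_variance_tendsto_zero
    (X := fun n ω => ∑ i ∈ Finset.range n, rem g θ₀ D i (Y i ω) (t n)) ?_ ?_ ?_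
  · filter_upwards [h2] with n hn
    exact memLp_finsetSum (Finset.range n) fun i hi => hn i hi
  · refine hvar.congr' ?_
    filter_upwards [h2, ht] with n hn htn
    have hs : (fun ω => ∑ i ∈ Finset.range n, rem g θ₀ D i (Y i ω) (t n))
        = ∑ i ∈ Finset.range n, fun ω => rem g θ₀ D i (Y i ω) (t n) := by
      ext ω; simp
    have hvs := IndepFun.variance_sum (μ := μ) (s := Finset.range n)
      (X := fun i ω => rem g θ₀ D i (Y i ω) (t n)) hn fun i _ j _ hij =>
        (hindep.indepFun hij).comp (hrm n i htn) (hrm n j htn)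
    rw [hs, ← ofReal_variance (memLp_finsetSum' (Finset.range n) fun i hi => hn i hi), hvs,
      ENNReal.ofReal_sum_of_nonneg fun i _ => variance_nonneg _ _]
    exact Finset.sum_congr rfl fun i hi => (ofReal_variance (hn i hi)).symm
  · have hlim := hmean.add (((hJ.sub_const c)).const_mul (1 / 2))
    simp only [sub_self, mul_zero, add_zero] at hlim
    refine hlim.congr' ?_
    filter_upwards [h2] with n hn
    rw [integral_finsetSum _ fun i hi => (hn i hi).integrable one_le_two]
    simp only [meanErr, Jsum, act_sum_left, inner_sum]
    rw [Finset.sum_sub_distrib, ← Finset.mul_sum]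
    ring

/-- Normalised sums with bounded variances are bounded in probability. -/
lemma exists_measure_norm_act_Dsum_le (hindep : iIndepFun Y μ)
    (hDm : ∀ i, Measurable (D i)) (hD2 : ∀ i, MemLp (fun ω => D i (Y i ω)) 2 μ)
    (hD0 : ∀ i, ∫ ω, D i (Y i ω) ∂μ = 0) {L : ℕ → Matrix (Fin p) (Fin p) ℝ}
    (hLt : ∀ n, (L n)ᵀ = L n) {C : ℝ}
    (hK : ∀ᶠ n in atTop, ∀ a, (L n * Ksum μ Y D n * L n) a a ≤ C) {ε : ℝ≥0∞} (hε : 0 < ε) :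
    ∃ R : ℝ, 0 < R ∧ ∀ᶠ n in atTop, μ {ω | R < ‖act (L n) (Dsum Y D n ω)‖} ≤ ε := by
  -- The second moment is the trace of `L_n K_n L_n`, and Markov's inequality applies to the squared
  -- norm.
  have hmom : ∀ n, ∫ ω, ‖act (L n) (Dsum Y D n ω)‖ ^ 2 ∂μ
      = ∑ a, (L n * Ksum μ Y D n * L n) a a := by
    intro n
    have he : ∀ ω, ‖act (L n) (Dsum Y D n ω)‖ ^ 2 = ∑ a,
        inner ℝ (act (L n) (EuclideanSpace.single a (1 : ℝ))) (Dsum Y D n ω) ^ 2 := fun ω => by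
      rw [EuclideanSpace.real_norm_sq_eq]
      refine Finset.sum_congr rfl fun a _ => ?_
      rw [inner_act_left, hLt]
      simp [EuclideanSpace.inner_single_left]
    simp only [he]
    rw [integral_finsetSum _ fun a _ => ((memLp_Dsum hD2 n).const_inner _).integrable_sq]
    refine Finset.sum_congr rfl fun a _ => ?_
    rw [integral_sq_inner_Dsum hindep hDm hD2 hD0, inner_act_left, hLt, ← act_mul, ← act_mul,
      inner_act_single]
  set B : ℝ := p * |C| + 1 with hB
  have hBpos : 0 < B := by positivity
  have hlim : Tendsto (fun R : ℝ => ENNReal.ofReal (B / R ^ 2)) atTop (𝓝 0) := by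
    rw [← ENNReal.ofReal_zero]
    exact ENNReal.tendsto_ofReal (tendsto_const_nhds.div_atTop (tendsto_pow_atTop two_ne_zero))
  obtain ⟨R, hRε, hR⟩ := ((hlim.eventually_lt_const hε).and (eventually_gt_atTop 0)).exists
  refine ⟨R, hR, ?_⟩
  filter_upwards [hK] with n hn
  refine le_trans ?_ hRε.le
  have hW : MemLp (fun ω => act (L n) (Dsum Y D n ω)) 2 μ :=
    (Matrix.toEuclideanCLM (𝕜 := ℝ) (L n)).comp_memLp' (memLp_Dsum hD2 n)
  have hmk := mul_meas_ge_le_integral_of_nonneg (μ := μ)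
    (f := fun ω => ‖act (L n) (Dsum Y D n ω)‖ ^ 2) (ae_of_all _ fun ω => by positivity)
    (hW.norm.integrable_sq) (R ^ 2)
  have hle : ∫ ω, ‖act (L n) (Dsum Y D n ω)‖ ^ 2 ∂μ ≤ B := by
    rw [hmom]
    calc ∑ a, (L n * Ksum μ Y D n * L n) a a ≤ ∑ _a : Fin p, |C| :=
          Finset.sum_le_sum fun a _ => (hn a).trans (le_abs_self C)
      _ ≤ B := by simp [hB]
  calc μ {ω | R < ‖act (L n) (Dsum Y D n ω)‖}
      ≤ μ {ω | R ^ 2 ≤ ‖act (L n) (Dsum Y D n ω)‖ ^ 2} := by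
        refine measure_mono fun ω hω => ?_
        have : R < ‖act (L n) (Dsum Y D n ω)‖ := hω
        change R ^ 2 ≤ ‖act (L n) (Dsum Y D n ω)‖ ^ 2
        gcongr
    _ = ENNReal.ofReal (μ.real {ω | R ^ 2 ≤ ‖act (L n) (Dsum Y D n ω)‖ ^ 2}) := by
        rw [ofReal_measureReal]
    _ ≤ ENNReal.ofReal (B / R ^ 2) := by
        refine ENNReal.ofReal_le_ofReal ?_
        rw [le_div_iff₀ (by positivity), mul_comm]
        exact hmk.trans hle

/-- The linear expansion of the minimisers, for normalisation by invertible matrices `N n` with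
inverses `L n`. -/
lemma tendstoInMeasure_act_argmin_sub (hY : ∀ i, Measurable (Y i)) (hindep : iIndepFun Y μ)
    {Θ : Set (E p)} {θ₀ : E p} (hθ₀ : θ₀ ∈ Θ)
    {g : ∀ i, 𝓨 i → E p → ℝ} (hgm : ∀ i, ∀ θ ∈ Θ, Measurable fun y => g i y θ)
    (hΘc : Convex ℝ Θ) (hgc : ∀ i y, ConvexOn ℝ Θ (g i y))
    (hDm : ∀ i, Measurable (D i)) (hD2 : ∀ i, MemLp (fun ω => D i (Y i ω)) 2 μ)
    (hD0 : ∀ i, ∫ ω, D i (Y i ω) ∂μ = 0) {A : ℕ → Matrix (Fin p) (Fin p) ℝ}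
    {θhat : ℕ → Ω → E p}
    (hθmin : Tendsto (fun n : ℕ => μ {ω | ¬ (θhat n ω ∈ Θ ∧
      IsMinOn (fun θ => ∑ i ∈ Finset.range n, g i (Y i ω) θ) Θ (θhat n ω))}) atTop (𝓝 0))
    {L N : ℕ → Matrix (Fin p) (Fin p) ℝ} (hLt : ∀ n, (L n)ᵀ = L n)
    (hLN : ∀ᶠ n in atTop, L n * N n = 1)
    (hΘ : ∀ s : E p, ∀ᶠ n in atTop, θ₀ + act (L n) s ∈ Θ)
    (hmean : ∀ s : E p, Tendsto (fun n : ℕ => ∑ i ∈ Finset.range n,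
      meanErr μ Y g θ₀ D A i (act (L n) s)) atTop (𝓝 0))
    (hvar : ∀ s : E p, Tendsto (fun n : ℕ => ∑ i ∈ Finset.range n,
      remVar μ Y g θ₀ D i (act (L n) s)) atTop (𝓝 0))
    {J : Matrix (Fin p) (Fin p) ℝ} (hJ : J.PosDef)
    (hJn : Tendsto (fun n => L n * Jsum A n * L n) atTop (𝓝 J)) {C : ℝ}
    (hK : ∀ᶠ n in atTop, ∀ a, (L n * Ksum μ Y D n * L n) a a ≤ C) :
    TendstoInMeasure μ (fun n ω => act (N n) (θhat n ω - θ₀)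
      - (-act J⁻¹ (act (L n) (Dsum Y D n ω)))) atTop fun _ => 0 := by
  obtain ⟨c, hc, hcoer⟩ := exists_pos_mul_sq_norm_le_inner_act hJ
  have hJt : Jᵀ = J := transpose_eq_of_posSemidef hJ.posSemidef
  have hJJ : J * J⁻¹ = 1 := Matrix.mul_nonsing_inv _ (isUnit_iff_ne_zero.2 hJ.det_pos.ne')
  refine tendstoInMeasure_argmin_sub (T := Matrix.toEuclideanCLM (𝕜 := ℝ) J) (c := c)
    (S := fun n => {s | θ₀ + act (L n) s ∈ Θ})
    (f := fun n ω s => ∑ i ∈ Finset.range n, g i (Y i ω) (θ₀ + act (L n) s)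
      - ∑ i ∈ Finset.range n, g i (Y i ω) θ₀) ?_ hc hcoer ?_ hΘ ?_ ?_ ?_
  · intro x y
    have := inner_act_left J x y
    rwa [hJt] at this
  · refine Eventually.of_forall fun n ω => ?_
    have hsum : ConvexOn ℝ Θ fun θ => ∑ i ∈ Finset.range n, g i (Y i ω) θ := by
      have : ∀ s : Finset ℕ, ConvexOn ℝ Θ fun θ => ∑ i ∈ s, g i (Y i ω) θ := fun s => by
        classical
        induction s using Finset.induction_on with
        | empty => simpa using convexOn_const 0 hΘc
        | insert i s hi ih =>
          simp only [Finset.sum_insert hi]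
          exact (hgc i (Y i ω)).add ih
      exact this _
    have := (hsum.comp_affineMap (AffineMap.const ℝ (E p) θ₀
      + (Matrix.toEuclideanCLM (𝕜 := ℝ) (L n)).toLinearMap.toAffineMap)).add_const
        (-∑ i ∈ Finset.range n, g i (Y i ω) θ₀)
    exact this
  · intro ε hε
    obtain ⟨R, hR, hRn⟩ := exists_measure_norm_act_Dsum_le hindep hDm hD2 hD0 hLt hK hε
    set B := ‖Matrix.toEuclideanCLM (𝕜 := ℝ) J⁻¹‖ with hB
    refine ⟨(B + 1) * R, by positivity, ?_⟩
    filter_upwards [hRn] with n hn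
    refine (measure_mono fun ω hω => ?_).trans hn
    have hω' : (B + 1) * R < ‖-act J⁻¹ (act (L n) (Dsum Y D n ω))‖ := hω
    rw [norm_neg] at hω'
    have hle : ‖act J⁻¹ (act (L n) (Dsum Y D n ω))‖ ≤ B * ‖act (L n) (Dsum Y D n ω)‖ :=
      ContinuousLinearMap.le_opNorm _ _
    change R < ‖act (L n) (Dsum Y D n ω)‖
    by_contra! hcon
    have hB0 : 0 ≤ B := norm_nonneg _
    nlinarith [mul_le_mul_of_nonneg_left hcon hB0]
  · intro s
    have hq : Tendsto (fun n => inner ℝ (act (L n) s) (act (Jsum A n) (act (L n) s))) atTop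
        (𝓝 (inner ℝ s (act J s))) := by
      refine (tendsto_inner_act hJn s s).congr fun n => ?_
      rw [act_mul, act_mul, inner_act_left, hLt]
    refine (tendstoInMeasure_sum_rem_sub hY hindep hθ₀ hgm hDm (hΘ s) (hmean s) (hvar s) hq).congr'
      (Eventually.of_forall fun n => ae_of_all _ fun ω => ?_) (ae_of_all _ fun ω => rfl)
    -- By the choice of `u_n` the linear terms cancel exactly, leaving the sum of the remainders
    -- minus `½ ⟨s, Js⟩`.
    have hT : Matrix.toEuclideanCLM (𝕜 := ℝ) J (-act J⁻¹ (act (L n) (Dsum Y D n ω)))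
        = -act (L n) (Dsum Y D n ω) := by
      change act J _ = _
      rw [act_neg, ← act_mul, hJJ, act_one]
    have hD : inner ℝ (act (L n) (Dsum Y D n ω)) s
        = ∑ i ∈ Finset.range n, inner ℝ (D i (Y i ω)) (act (L n) s) := by
      rw [inner_act_left, hLt, Dsum, sum_inner]
    have hJs : Matrix.toEuclideanCLM (𝕜 := ℝ) J s = act J s := rfl
    simp only [hT, hJs, inner_neg_left, hD, rem, Finset.sum_sub_distrib]
    ring
  · refine tendsto_of_tendsto_of_tendsto_of_le_of_le' tendsto_const_nhds hθmin
      (Eventually.of_forall fun _ => zero_le) ?_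
    filter_upwards [hLN] with n hn
    refine measure_mono fun ω hω hcon => hω ?_
    -- The localised criterion at the normalised estimator is the original one at `θhat`, up to a
    -- constant, so minimality carries over.
    have hback : θ₀ + act (L n) (act (N n) (θhat n ω - θ₀)) = θhat n ω := by
      rw [← act_mul, hn, act_one]; abel
    refine ⟨?_, fun s hs => ?_⟩
    · rw [hback]; exact hcon.1
    · have := hcon.2 hs
      simp only [Set.mem_ofPred_eq, hback] at this ⊢
      linarith

end LinearExpansion

/-! ### Gaussian limits under the two normalisations. -/

section AsymptoticNormality

lemma exists_eventually_diag_le_of_tendsto {p : ℕ} {M : ℕ → Matrix (Fin p) (Fin p) ℝ}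
    {M₀ : Matrix (Fin p) (Fin p) ℝ} (h : Tendsto M atTop (𝓝 M₀)) :
    ∃ C : ℝ, ∀ᶠ n in atTop, ∀ a, M n a a ≤ C := by
  refine ⟨(∑ a, |M₀ a a|) + 1, eventually_all.2 fun a => ?_⟩
  have ha : Tendsto (fun n => M n a a) atTop (𝓝 (M₀ a a)) :=
    ((continuous_apply_apply a a).tendsto M₀).comp h
  have hle : |M₀ a a| ≤ ∑ a, |M₀ a a| :=
    Finset.single_le_sum (f := fun a => |M₀ a a|) (fun _ _ => abs_nonneg _) (Finset.mem_univ a)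
  have hlt : M₀ a a < (∑ a, |M₀ a a|) + 1 := by linarith [le_abs_self (M₀ a a)]
  exact (ha.eventually_lt_const hlt).mono fun n hn => hn.le

lemma smul_one_mul_mul_smul_one {p : ℕ} (n : ℕ) (M : Matrix (Fin p) (Fin p) ℝ) :
    ((√(n : ℝ))⁻¹ • (1 : Matrix (Fin p) (Fin p) ℝ)) * M * ((√(n : ℝ))⁻¹ • 1) = (n : ℝ)⁻¹ • M := by
  rw [smul_mul_assoc, one_mul, mul_smul_comm, mul_one, smul_smul, ← mul_inv,
    Real.mul_self_sqrt (Nat.cast_nonneg n)]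

variable {Ω : Type*} [MeasurableSpace Ω] {μ : Measure Ω} [IsProbabilityMeasure μ]
  {p : ℕ} {𝓨 : ℕ → Type*} [∀ i, MeasurableSpace (𝓨 i)] {Y : ∀ i, Ω → 𝓨 i} {D : ∀ i, 𝓨 i → E p}

/-- Asymptotic normality of `-J⁻¹ n^{-1/2} ∑_{i<n} D_i(Y_i)`. -/
lemma tendstoInDistribution_sqrt_normalised (hY : ∀ i, Measurable (Y i)) (hindep : iIndepFun Y μ)
    (hDm : ∀ i, Measurable (D i)) (hD2 : ∀ i, MemLp (fun ω => D i (Y i ω)) 2 μ)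
    (hD0 : ∀ i, ∫ ω, D i (Y i ω) ∂μ = 0) {J K : Matrix (Fin p) (Fin p) ℝ} (hJ : J.PosDef)
    (hK : Tendsto (fun n : ℕ => (n : ℝ)⁻¹ • Ksum μ Y D n) atTop (𝓝 K))
    (hL : Lindeberg μ (fun (n i : ℕ) ω => (√(n : ℝ))⁻¹ • D i (Y i ω))) :
    TendstoInDistribution (fun (n : ℕ) ω => -act J⁻¹ ((√(n : ℝ))⁻¹ • Dsum Y D n ω)) atTop id
      (fun _ => μ) (multivariateGaussian 0 (J⁻¹ * K * J⁻¹)) := by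
  have hJt : (J⁻¹)ᵀ = J⁻¹ := transpose_eq_of_posSemidef hJ.inv.posSemidef
  have hKps : K.PosSemidef := posSemidef_of_tendsto
    (Eventually.of_forall fun n => (posSemidef_Ksum hD2 n).smul (by positivity)) hK
  refine tendstoInDistribution_multivariateGaussian (fun n => ?_)
    (posSemidef_mul_mul_self hJt hKps) fun s => ?_
  · have hm := measurable_Dsum hY hDm n
    have hm' : Measurable fun ω => (√(n : ℝ))⁻¹ • Dsum Y D n ω := by fun_prop
    exact ((measurable_act J⁻¹).comp hm').neg.aemeasurable
  · simp only [← act_smul_one] at hL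
    have hv : Tendsto (fun n : ℕ => inner ℝ (-act J⁻¹ s)
        (act (((√(n : ℝ))⁻¹ • (1 : Matrix (Fin p) (Fin p) ℝ)) * Ksum μ Y D n
          * ((√(n : ℝ))⁻¹ • 1)) (-act J⁻¹ s))) atTop
        (𝓝 (inner ℝ s (act (J⁻¹ * K * J⁻¹) s))) := by
      simp only [smul_one_mul_mul_smul_one]
      have h1 := tendsto_inner_act hK (-act J⁻¹ s) (-act J⁻¹ s)
      have h2 : inner ℝ (-act J⁻¹ s) (act K (-act J⁻¹ s))
          = inner ℝ s (act (J⁻¹ * K * J⁻¹) s) := by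
        rw [act_neg, inner_neg_neg, inner_act_left, hJt, ← act_mul, ← act_mul]
      rwa [h2] at h1
    have key := tendsto_integral_cexp_inner_act_Dsum hY hindep hDm hD2 hD0 hL (fun n => by simp)
      (t := fun _ => -act J⁻¹ s) (Eventually.of_forall fun _ => le_rfl) hv
    refine key.congr fun n => integral_congr_ae (ae_of_all _ fun ω => ?_)
    simp only [act_smul_one, inner_neg_left, inner_neg_right, inner_act_left, hJt]

/-- The central limit theorem for the standardised sums. -/
lemma tendstoInDistribution_Ustd (hY : ∀ i, Measurable (Y i)) (hindep : iIndepFun Y μ)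
    (hDm : ∀ i, Measurable (D i)) (hD2 : ∀ i, MemLp (fun ω => D i (Y i ω)) 2 μ)
    (hD0 : ∀ i, ∫ ω, D i (Y i ω) ∂μ = 0) (hK : ∀ᶠ n in atTop, (Ksum μ Y D n).PosDef)
    (hL : Lindeberg μ (fun (n i : ℕ) ω => act (invRt (Ksum μ Y D n)) (D i (Y i ω)))) :
    TendstoInDistribution (Ustd μ Y D) atTop id (fun _ => μ) (multivariateGaussian 0 1) := by
  refine tendstoInDistribution_multivariateGaussian (fun n => ?_) Matrix.PosSemidef.one fun s => ?_
  · exact ((measurable_act _).comp (measurable_Dsum hY hDm n)).aemeasurable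
  · refine tendsto_integral_cexp_inner_act_Dsum hY hindep hDm hD2 hD0 hL
      (fun n => transpose_invRt _) (t := fun _ => s) (Eventually.of_forall fun _ => le_rfl) ?_
    refine tendsto_const_nhds.congr' ?_
    filter_upwards [hK] with n hn
    rw [invRt_mul_mul_invRt hn]

/-- Asymptotic normality of the sums normalised by symmetric matrices `L n` for which
`L n * K_n * L n` converges. -/
lemma tendstoInDistribution_act_mul_rt_Ustd (hY : ∀ i, Measurable (Y i)) (hindep : iIndepFun Y μ)
    (hDm : ∀ i, Measurable (D i)) (hD2 : ∀ i, MemLp (fun ω => D i (Y i ω)) 2 μ)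
    (hD0 : ∀ i, ∫ ω, D i (Y i ω) ∂μ = 0) (hK : ∀ᶠ n in atTop, (Ksum μ Y D n).PosDef)
    (hL : Lindeberg μ (fun (n i : ℕ) ω => act (invRt (Ksum μ Y D n)) (D i (Y i ω))))
    {L : ℕ → Matrix (Fin p) (Fin p) ℝ} (hLt : ∀ n, (L n)ᵀ = L n)
    {S : Matrix (Fin p) (Fin p) ℝ}
    (hS : Tendsto (fun n => L n * Ksum μ Y D n * L n) atTop (𝓝 S)) :
    TendstoInDistribution (fun n ω => -act (L n * rt (Ksum μ Y D n)) (Ustd μ Y D n ω)) atTop id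
      (fun _ => μ) (multivariateGaussian 0 S) := by
  have hSps : S.PosSemidef := posSemidef_of_tendsto
    (Eventually.of_forall fun n => posSemidef_mul_mul_self (hLt n) (posSemidef_Ksum hD2 n)) hS
  refine tendstoInDistribution_multivariateGaussian (fun n => ?_) hSps fun s => ?_
  · exact ((measurable_act _).comp ((measurable_act _).comp
      (measurable_Dsum hY hDm n))).neg.aemeasurable
  -- `L_n K_n^{1/2}` need not converge, so it is moved onto the argument: `t n` may oscillate, but
  -- `‖t n‖²` equals `⟨s, L_n K_n L_n s⟩`, which converges.
  set t : ℕ → E p := fun n => -act (rt (Ksum μ Y D n) * L n) s with ht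
  have htt : ∀ n, inner ℝ (t n) (t n) = inner ℝ s (act (L n * Ksum μ Y D n * L n) s) := by
    intro n
    rw [ht, inner_neg_neg, inner_act_left, Matrix.transpose_mul, transpose_rt, hLt, ← act_mul]
    congr 2
    rw [mul_assoc, ← mul_assoc (rt _), rt_mul_rt (posSemidef_Ksum hD2 n), ← mul_assoc]
  have hlim : Tendsto (fun n => inner ℝ (t n) (t n)) atTop (𝓝 (inner ℝ s (act S s))) :=
    (tendsto_inner_act hS s s).congr fun n => (htt n).symm
  have hbdd : ∀ᶠ n in atTop, ‖t n‖ ≤ inner ℝ s (act S s) + 2 := by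
    -- The bound on the norm follows from that on its square through `2‖t‖ ≤ ‖t‖² + 1`.
    filter_upwards [hlim.eventually_lt_const (lt_add_one _)] with n hn
    rw [real_inner_self_eq_norm_sq] at hn
    nlinarith [sq_nonneg (‖t n‖ - 1)]
  have key := tendsto_integral_cexp_inner_act_Dsum hY hindep hDm hD2 hD0 hL
    (fun n => transpose_invRt _) hbdd (v := inner ℝ s (act S s)) (hlim.congr' (by
      filter_upwards [hK] with n hn
      rw [invRt_mul_mul_invRt hn, act_one]))
  refine key.congr fun n => integral_congr_ae (ae_of_all _ fun ω => ?_)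
  simp only [ht, Ustd, inner_neg_left, inner_neg_right]
  rw [inner_act_left _ s, Matrix.transpose_mul, transpose_rt, hLt]

end AsymptoticNormality

end

end ConvexMin

/-! ### The two asymptotic statements. -/

open ConvexMin in
theorem theorem2p2
    {Ω : Type*} [MeasurableSpace Ω] (μ : Measure Ω) [IsProbabilityMeasure μ]
    {p : ℕ} {𝓨 : ℕ → Type*} [∀ i, MeasurableSpace (𝓨 i)]
    -- independent observations
    (Y : ∀ i, Ω → 𝓨 i) (hY : ∀ i, Measurable (Y i)) (hindep : iIndepFun Y μ)
    -- parameter region and true parameter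
    (Θ : Set (E p)) (hΘo : IsOpen Θ) (hΘc : Convex ℝ Θ) (θ₀ : E p) (hθ₀ : θ₀ ∈ Θ)
    -- convex criterion functions
    (g : ∀ i, 𝓨 i → E p → ℝ) (hgm : ∀ i, ∀ θ ∈ Θ, Measurable fun y => g i y θ)
    (hgc : ∀ i y, ConvexOn ℝ Θ (g i y))
    -- the linear terms of the expansions: mean zero, finite variance matrix
    (D : ∀ i, 𝓨 i → E p) (hDm : ∀ i, Measurable (D i))
    (hD2 : ∀ i, MemLp (fun ω => D i (Y i ω)) 2 μ) (hD0 : ∀ i, ∫ ω, D i (Y i ω) ∂μ = 0)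
    -- the matrices of the quadratic terms of the expansions of the means
    (A : ℕ → Matrix (Fin p) (Fin p) ℝ)
    -- the estimators, which are minimisers with probability tending to one
    (θhat : ℕ → Ω → E p) (hθm : ∀ n, AEMeasurable (θhat n) μ)
    (hθmin : Tendsto (fun n : ℕ => μ {ω | ¬ (θhat n ω ∈ Θ ∧
      IsMinOn (fun θ => ∑ i ∈ Finset.range n, g i (Y i ω) θ) Θ (θhat n ω))}) atTop (𝓝 0)) :
    -- normalisation by the square root of `n`
    (∀ J K : Matrix (Fin p) (Fin p) ℝ, J.PosDef →
      (∀ s : E p, Tendsto (fun n : ℕ => ∑ i ∈ Finset.range n,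
        meanErr μ Y g θ₀ D A i ((√(n : ℝ))⁻¹ • s)) atTop (𝓝 0)) →
      (∀ s : E p, Tendsto (fun n : ℕ => ∑ i ∈ Finset.range n,
        remVar μ Y g θ₀ D i ((√(n : ℝ))⁻¹ • s)) atTop (𝓝 0)) →
      Tendsto (fun n : ℕ => (n : ℝ)⁻¹ • Jsum A n) atTop (𝓝 J) →
      Tendsto (fun n : ℕ => (n : ℝ)⁻¹ • Ksum μ Y D n) atTop (𝓝 K) →
      TendstoInMeasure μ
        (fun (n : ℕ) ω => √(n : ℝ) • (θhat n ω - θ₀)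
          - (-act J⁻¹ ((√(n : ℝ))⁻¹ • Dsum Y D n ω))) atTop (fun _ => 0) ∧
      (Lindeberg μ (fun (n i : ℕ) ω => (√(n : ℝ))⁻¹ • D i (Y i ω)) →
        TendstoInDistribution (fun (n : ℕ) ω => √(n : ℝ) • (θhat n ω - θ₀)) atTop id
          (fun _ => μ) (multivariateGaussian 0 (J⁻¹ * K * J⁻¹)))) ∧
    -- normalisation by the root of `J_n`
    ((∀ᶠ n in atTop, (Jsum A n).PosDef) → (∀ᶠ n in atTop, (Ksum μ Y D n).PosDef) →
      (∀ s : E p, ∀ᶠ n in atTop, θ₀ + act (invRt (Jsum A n)) s ∈ Θ) →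
      (∀ s : E p, Tendsto (fun n : ℕ => ∑ i ∈ Finset.range n,
        meanErr μ Y g θ₀ D A i (act (invRt (Jsum A n)) s)) atTop (𝓝 0)) →
      (∀ s : E p, Tendsto (fun n : ℕ => ∑ i ∈ Finset.range n,
        remVar μ Y g θ₀ D i (act (invRt (Jsum A n)) s)) atTop (𝓝 0)) →
      (∃ C : ℝ, ∀ᶠ n in atTop, ∀ a b, |((Jsum A n)⁻¹ * Ksum μ Y D n) a b| ≤ C) →
      TendstoInMeasure μ
        (fun (n : ℕ) ω => act (rt (Jsum A n)) (θhat n ω - θ₀)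
          - (-act (invRt (Jsum A n) * rt (Ksum μ Y D n)) (Ustd μ Y D n ω)))
        atTop (fun _ => 0) ∧
      (Lindeberg μ (fun (n i : ℕ) ω => act (invRt (Ksum μ Y D n)) (D i (Y i ω))) →
        TendstoInDistribution (Ustd μ Y D) atTop id (fun _ => μ) (multivariateGaussian 0 1) ∧
        ∀ J K : Matrix (Fin p) (Fin p) ℝ, J.PosDef →
          Tendsto (fun n : ℕ => invRt (Jsum A n) * Ksum μ Y D n * invRt (Jsum A n)) atTop
            (𝓝 (invRt J * K * invRt J)) →
          TendstoInDistribution (fun (n : ℕ) ω => act (rt (Jsum A n)) (θhat n ω - θ₀)) atTop id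
            (fun _ => μ) (multivariateGaussian 0 (invRt J * K * invRt J)))) := by
  refine ⟨fun J K hJ hmean hvar hJn hKn => ?_, fun hJp hKp hΘ hmean hvar hbdd => ?_⟩
  · have hexp : TendstoInMeasure μ
        (fun (n : ℕ) ω => √(n : ℝ) • (θhat n ω - θ₀)
          - (-act J⁻¹ ((√(n : ℝ))⁻¹ • Dsum Y D n ω))) atTop (fun _ => 0) := by
      obtain ⟨C, hC⟩ := exists_eventually_diag_le_of_tendsto hKn
      have h := tendstoInMeasure_act_argmin_sub hY hindep hθ₀ hgm hΘc hgc hDm hD2 hD0 (A := A)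
        hθmin (L := fun n => (√(n : ℝ))⁻¹ • (1 : Matrix (Fin p) (Fin p) ℝ))
        (N := fun n => √(n : ℝ) • (1 : Matrix (Fin p) (Fin p) ℝ)) (fun n => by simp) ?_ ?_
        (by simpa only [act_smul_one] using hmean) (by simpa only [act_smul_one] using hvar) hJ
        (by simpa only [smul_one_mul_mul_smul_one] using hJn) (C := C)
        (by simpa only [smul_one_mul_mul_smul_one] using hC)
      · simpa only [act_smul_one] using h
      -- At `n = 0` the inverse root takes the default value zero, so the two scalings are inverse
      -- only for `n > 0`.
      · filter_upwards [eventually_gt_atTop 0] with n hn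
        have : √(n : ℝ) ≠ 0 := (Real.sqrt_pos.2 (by exact_mod_cast hn)).ne'
        simp [smul_smul, mul_inv_cancel₀ this]
      · intro s
        simp only [act_smul_one]
        have hs : Tendsto (fun n : ℕ => θ₀ + (√(n : ℝ))⁻¹ • s) atTop (𝓝 (θ₀ + (0 : ℝ) • s)) := by
          refine Tendsto.const_add _ (Tendsto.smul_const ?_ _)
          exact tendsto_inv_atTop_zero.comp
            (Real.tendsto_sqrt_atTop.comp tendsto_natCast_atTop_atTop)
        rw [zero_smul, add_zero] at hs
        exact hs.eventually (hΘo.mem_nhds hθ₀)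
    refine ⟨hexp, fun hL => ?_⟩
    exact tendstoInDistribution_of_tendstoInMeasure_sub _ _
      (tendstoInDistribution_sqrt_normalised hY hindep hDm hD2 hD0 hJ hKn hL) hexp
      fun n => ((hθm n).sub_const θ₀).fun_const_smul _
  · have hexp : TendstoInMeasure μ
        (fun (n : ℕ) ω => act (rt (Jsum A n)) (θhat n ω - θ₀)
          - (-act (invRt (Jsum A n) * rt (Ksum μ Y D n)) (Ustd μ Y D n ω)))
        atTop (fun _ => 0) := by
      obtain ⟨C, hC⟩ := hbdd
      have h := tendstoInMeasure_act_argmin_sub hY hindep hθ₀ hgm hΘc hgc hDm hD2 hD0 (A := A)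
        hθmin (L := fun n => invRt (Jsum A n)) (N := fun n => rt (Jsum A n))
        (fun n => transpose_invRt _) (hJp.mono fun n hn => invRt_mul_rt hn) hΘ hmean hvar
        -- Normalised by its own root, `J_n` becomes the identity, which is the limiting quadratic
        -- form here.
        Matrix.PosDef.one (tendsto_const_nhds.congr' (hJp.mono fun n hn =>
          (invRt_mul_mul_invRt hn).symm)) (C := p * C) (by
            filter_upwards [hJp, hC] with n hn hCn
            exact diag_invRt_mul_mul_invRt_le hn (posSemidef_Ksum hD2 n) hCn)
      refine h.congr' ?_ (ae_of_all _ fun ω => rfl)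
      filter_upwards [hKp] with n hn
      refine ae_of_all _ fun ω => ?_
      simp only [inv_one, act_one, Ustd]
      rw [← act_mul, mul_assoc, rt_mul_invRt hn, mul_one]
    refine ⟨hexp, fun hL => ⟨tendstoInDistribution_Ustd hY hindep hDm hD2 hD0 hKp hL,
      fun J K _ hJK => ?_⟩⟩
    exact tendstoInDistribution_of_tendstoInMeasure_sub _ _
      (tendstoInDistribution_act_mul_rt_Ustd hY hindep hDm hD2 hD0 hKp hL
        (fun n => transpose_invRt _) hJK) hexp
      fun n => (measurable_act _).comp_aemeasurable ((hθm n).sub_const θ₀)
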